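/- Let $K$ be a field, let $S=K[x_1,\dots,x_n]$ with its standard grading, and let $\Delta$ be a $(d-1)$-dimensional simplicial complex on the vertex set $[n]$ (so $\emptyset\in\Delta$ and $\{v\}\in\Delta$ for every $v\in[n]$). Let $I_\Delta\subseteq S$ be its Stanley–Reisner ideal, generated by the square-free monomials $\prod_{v\in F}x_v$ with $F\subseteq[n]$, $F\notin\Delta$. For a homogeneous ideal $I\subseteq S$ let $\operatorname{indeg}(I)=\inf\{i: I_i\neq 0\}$ (with $\operatorname{indeg}(0)=\infty$); let $\beta_{i,j}(I)$ be its graded Betti numbers, i.e. the minimal graded free resolution $\cdots\to F_1\to F_0\to I\to 0$ (which exists for $I=I_\Delta$) has $F_i=\bigoplus_j S(-j)^{\beta_{i,j}(I)}$; and for $I\ne 0$ let $\operatorname{reg}(I)=\sup\{j-i:\beta_{i,j}(I)\neq 0\}$. A nonzero homogeneous ideal $I$ is said to have a $k$-linear resolution if $\operatorname{reg}(I)=\operatorname{indeg}(I)=k$. Suppose that $\operatorname{indeg}(I_\Delta)\ge d$. Then: (i) if $\beta_{i,j}(I_\Delta)\neq 0$, then $1\le j\le n$ and $d\le j-i\le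 d+1$. If moreover $I_\Delta\neq 0$ (that is, $\Delta$ is not the full simplex on $[n]$), then: (ii) $d\le \operatorname{reg}(I_\Delta)\le d+1$; (iii) $\operatorname{indeg}(I_\Delta)\le d+1$, and equality holds if and only if $I_\Delta$ has a $(d+1)$-linear resolution; (iv) $n-d-1\le \operatorname{projdim}_S(I_\Delta)\le n-d$. -/

import Mathlib

open MvPolynomial

namespace StanleyReisner

/-- The faces of a simplicial complex, the empty face included
(Mathlib's `AbstractSimplicialComplex.faces` lists the nonempty faces only). -/
def IsFace {n : ℕ} (Δ : AbstractSimplicialComplex (Fin n)) (F : Finset (Fin n)) : Prop :=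
  F = ∅ ∨ F ∈ Δ.faces

open Classical in
/-- The dimension of a simplicial complex on `[n]`: the maximum of `|F| - 1` over its faces `F`.
It is `-1` for the complex whose only face is `∅` (which occurs only for `n = 0`). -/
noncomputable def dim {n : ℕ} (Δ : AbstractSimplicialComplex (Fin n)) : ℤ :=
  (((Finset.univ.filter (IsFace Δ)).sup Finset.card : ℕ) : ℤ) - 1

/-- The Stanley-Reisner (non-face) ideal of `Δ` in `K[x_1, …, x_n]`: it is generated by the
square-free monomials whose support is not a face of `Δ`. -/
noncomputable def stanleyReisnerIdeal (K : Type*) [Field K] {n : ℕ}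
    (Δ : AbstractSimplicialComplex (Fin n)) : Ideal (MvPolynomial (Fin n) K) :=
  Ideal.span {p | ∃ F : Finset (Fin n), ¬ IsFace Δ F ∧ p = ∏ v ∈ F, X v}

/-- The initial degree of a homogeneous ideal `I`: the least `i` such that `I` contains a nonzero
form of degree `i` (`⊤` if `I = 0`). -/
noncomputable def indeg {K : Type*} [Field K] {n : ℕ} (I : Ideal (MvPolynomial (Fin n) K)) : ℕ∞ :=
  sInf {k : ℕ∞ | ∃ i : ℕ, k = i ∧ ∃ f ∈ I, f ≠ 0 ∧ f.IsHomogeneous i}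

/-- A minimal graded free resolution
`⋯ → F_2 → F_1 → F_0 → I → 0` of an ideal `I` of `S = K[x_1, …, x_n]`.
Here `F_i` is the free module with basis indexed by `Fin (rank i)`, whose `b`-th basis element has
degree `deg i b`; that is, `F_i = ⨁_b S(-deg i b)`. -/
structure MinimalGradedFreeResolution {K : Type*} [Field K] {n : ℕ}
    (I : Ideal (MvPolynomial (Fin n) K)) where
  /-- the rank of `F_i` -/
  rank : ℕ → ℕ
  /-- the degrees of the basis elements of `F_i` -/
  deg : (i : ℕ) → Fin (rank i) → ℕ
  /-- the augmentation `F_0 → I`, as a map to `S` -/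
  aug : (Fin (rank 0) → MvPolynomial (Fin n) K) →ₗ[MvPolynomial (Fin n) K] MvPolynomial (Fin n) K
  /-- the differential `F_{i+1} → F_i` -/
  d : (i : ℕ) → (Fin (rank (i + 1)) → MvPolynomial (Fin n) K) →ₗ[MvPolynomial (Fin n) K]
    (Fin (rank i) → MvPolynomial (Fin n) K)
  /-- the augmentation is homogeneous of degree `0` -/
  aug_homogeneous : ∀ b, (aug (Pi.single b 1)).IsHomogeneous (deg 0 b)
  /-- the differentials are homogeneous of degree `0`: in the `c`-th coordinate of the image of the
  `b`-th basis element, each monomial `m` satisfies `|m| + deg c = deg b` -/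
  d_homogeneous : ∀ i b c, ∀ m ∈ (d i (Pi.single b 1) c).support,
    m.degree + deg i c = deg (i + 1) b
  /-- the augmentation maps onto `I` -/
  range_aug : LinearMap.range aug = I
  /-- exactness at `F_0` -/
  exact_zero : LinearMap.range (d 0) = LinearMap.ker aug
  /-- exactness at `F_{i+1}` -/
  exact_succ : ∀ i, LinearMap.range (d (i + 1)) = LinearMap.ker (d i)
  /-- minimality: the image of `F_{i+1}` lies in `(x_1, …, x_n) F_i` -/
  minimal : ∀ i x c, constantCoeff (d i x c) = 0

namespace MinimalGradedFreeResolution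

variable {K : Type*} [Field K] {n : ℕ} {I : Ideal (MvPolynomial (Fin n) K)}

/-- The graded Betti number `β_{i,j}`: the number of summands `S(-j)` of `F_i`. -/
def betti (F : MinimalGradedFreeResolution I) (i j : ℕ) : ℕ :=
  (Finset.univ.filter fun b : Fin (F.rank i) => F.deg i b = j).card

/-- The Castelnuovo-Mumford regularity `sup {j - i : β_{i,j} ≠ 0}`, with values in `ℤ ∪ {±∞}`. -/
noncomputable def reg (F : MinimalGradedFreeResolution I) : WithBot (WithTop ℤ) :=
  sSup {r | ∃ i j : ℕ, F.betti i j ≠ 0 ∧ r = (((j : ℤ) - (i : ℤ) : ℤ) : WithBot (WithTop ℤ))}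

/-- `I` has a `k`-linear resolution: its regularity and its initial degree both equal `k`. -/
def IsLinear (F : MinimalGradedFreeResolution I) (k : ℕ) : Prop :=
  F.reg = (((k : ℤ) : ℤ) : WithBot (WithTop ℤ)) ∧ indeg I = k

end MinimalGradedFreeResolution

end StanleyReisner

/-!
The Stanley-Reisner ideal `I_Δ` has linear quotients, and everything is read off from that.

Since all faces have at most `d` vertices and all sets with fewer than `d` elements are faces,
`I_Δ` is generated by all square-free monomials of degree `d + 1` together with the `∏_{v ∈ F} x_v`
for the non-faces `F` with `d` elements (`stanleyReisnerIdeal_eq`). Take the former in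
colexicographic order and then the latter in any order. Each new generator `∏_{v ∈ F} x_v` has as
colon ideal over the previous ones a prime `(x_v : v ∈ V)` with `V` disjoint from `F`. The exact
sequences `0 → J → J + (w) → (S/(J : w))(-deg w) → 0`, the horseshoe lemma and the Koszul
resolutions of `(x_v : v ∈ V)`, which come from the same exact sequences, give a graded free
resolution of `I_Δ` whose degrees in homological degree `i` are `i + d + 1` or `i + d`, the latter
only if there are non-faces with `d` elements, and at most `n`
(`hasGradedResolution_sqfreeVeronese_union`). This resolution need not be minimal, but the degrees
of a minimal one occur in every other one: comparison maps in both directions compose to a map that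
is the identity modulo the variables, because homotopies vanish there
(`MinimalGradedFreeResolution.deg_of_hasGradedResolution`). This bounds the Betti numbers, hence the
regularity, and shows that a minimal resolution has length at most `n - d`. A minimal resolution
exists because a homogeneous system of generators with the fewest elements has no relation with a
unit coefficient (`exists_minimal_cover`).

For the lower bound on the projective dimension, let `H` be a face with `d` vertices and
`P = (x_v : v ∉ H)`. Multiplication by `∏_{v ∈ H} x_v` on `S/P` factors as `S/P → S/I_Δ → S/P`, so
it annihilates `Ext^{n-d}(S/P, S/P)` as soon as `S/I_Δ` has projective dimension less than `n - d`.
But `P` is generated by `n - d` variables that form a regular sequence and annihilate `S/P`, and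
iterated connecting homomorphisms embed `S/P` into that `Ext` module
(`exists_ext_smul_ne_zero`), on which `∏_{v ∈ H} x_v` therefore does not act as zero.
-/

namespace StanleyReisner

universe u

variable {K : Type u} [Field K] {n : ℕ}

/-! ### Shifted gradings -/

/-- The homogeneous elements of degree `j` in `S(-a)`: the forms of degree `j - a`, with the
condition written as an addition so that only `0` satisfies it for `j < a`. -/
def shiftGr (K : Type u) [Field K] (n : ℕ) (a j : ℕ) : AddSubgroup (MvPolynomial (Fin n) K) where
  carrier := {f | ∀ m, coeff m f ≠ 0 → m.degree + a = j}
  zero_mem' := by simp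
  add_mem' := by
    intro f g hf hg m hm
    by_cases h : coeff m f = 0
    · exact hg m (by simpa [h] using hm)
    · exact hf m h
  neg_mem' := by
    intro f hf m hm
    exact hf m (by simpa using hm)

lemma mem_shiftGr {a j : ℕ} {f : MvPolynomial (Fin n) K} :
    f ∈ shiftGr K n a j ↔ ∀ m, coeff m f ≠ 0 → m.degree + a = j := Iff.rfl

lemma mem_shiftGr_zero {j : ℕ} {f : MvPolynomial (Fin n) K} :
    f ∈ shiftGr K n 0 j ↔ f.IsHomogeneous j := by
  simp only [mem_shiftGr, IsHomogeneous, IsWeightedHomogeneous, add_zero,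
    Finsupp.degree_eq_weight_one]
  rfl

lemma mul_mem_shiftGr {a b j : ℕ} {f g : MvPolynomial (Fin n) K} (hf : f ∈ shiftGr K n b j)
    (hg : g ∈ shiftGr K n a b) : f * g ∈ shiftGr K n a j := by
  intro m hm
  rw [coeff_mul] at hm
  obtain ⟨x, hx, hne⟩ := Finset.exists_ne_zero_of_sum_ne_zero hm
  rw [Finset.HasAntidiagonal.mem_antidiagonal] at hx
  have h1 := hf x.1 (left_ne_zero_of_mul hne)
  have h2 := hg x.2 (right_ne_zero_of_mul hne)
  rw [← hx, map_add]
  omega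

lemma one_mem_shiftGr (a : ℕ) : (1 : MvPolynomial (Fin n) K) ∈ shiftGr K n a a := by
  intro m hm
  rw [coeff_one] at hm
  have : m = 0 := by
    by_contra h
    exact hm (if_neg fun h' => h h'.symm)
  simp [this]

lemma shiftGr_add {a b j : ℕ} : shiftGr K n (a + b) (j + b) = shiftGr K n a j := by
  ext f
  simp only [mem_shiftGr]
  refine forall₂_congr fun m _ => ?_
  omega

/-- The component of degree `j` of an element of `S(-a)`. -/
noncomputable def shiftComp (a j : ℕ) : MvPolynomial (Fin n) K →+ MvPolynomial (Fin n) K :=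
  if a ≤ j then (homogeneousComponent (j - a)).toAddMonoidHom else 0

lemma coeff_shiftComp (a j : ℕ) (f : MvPolynomial (Fin n) K) (m : Fin n →₀ ℕ) :
    coeff m (shiftComp a j f) = if m.degree + a = j then coeff m f else 0 := by
  unfold shiftComp
  split_ifs with h1 h2 h2
  · simp only [LinearMap.toAddMonoidHom_coe, coeff_homogeneousComponent]
    rw [if_pos (by omega)]
  · simp only [LinearMap.toAddMonoidHom_coe, coeff_homogeneousComponent]
    rw [if_neg (by omega)]
  · omega
  · simp

lemma shiftComp_mem (a j : ℕ) (f : MvPolynomial (Fin n) K) : shiftComp a j f ∈ shiftGr K n a j := by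
  intro m hm
  rw [coeff_shiftComp] at hm
  by_contra h
  exact hm (if_neg h)

lemma shiftComp_of_mem {a i : ℕ} {f : MvPolynomial (Fin n) K} (hf : f ∈ shiftGr K n a i) (j : ℕ) :
    shiftComp a j f = if i = j then f else 0 := by
  ext m
  rw [coeff_shiftComp]
  by_cases h : coeff m f = 0
  · split_ifs <;> simp [h]
  · have := hf m h
    subst this
    split_ifs <;> simp

lemma shiftComp_mul {a b : ℕ} {f : MvPolynomial (Fin n) K} (hf : f ∈ shiftGr K n a b) (j : ℕ)
    (p : MvPolynomial (Fin n) K) : shiftComp a j (p * f) = shiftComp b j p * f := by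
  induction p using MvPolynomial.induction_on' with
  | monomial m c =>
    have hm : monomial m c ∈ shiftGr K n b (m.degree + b) := by
      intro m' hm'
      rw [coeff_monomial] at hm'
      have : m = m' := by
        by_contra h
        exact hm' (if_neg h)
      rw [this]
    rw [shiftComp_of_mem (mul_mem_shiftGr hm hf), shiftComp_of_mem hm]
    split_ifs <;> simp
  | add p q hp hq => rw [add_mul, map_add, hp, hq, map_add, add_mul]

/-- Elements of degree `j` in the free module `⨁_b S(-deg b)`. -/
noncomputable def freeGr (K : Type u) [Field K] (n : ℕ) {ι : Type} (deg : ι → ℕ) (j : ℕ) :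
    AddSubgroup (ι → MvPolynomial (Fin n) K) :=
  AddSubgroup.pi Set.univ fun b => shiftGr K n (deg b) j

lemma mem_freeGr {ι : Type} {deg : ι → ℕ} {j : ℕ} {x : ι → MvPolynomial (Fin n) K} :
    x ∈ freeGr K n deg j ↔ ∀ b, x b ∈ shiftGr K n (deg b) j := by
  simp [freeGr, AddSubgroup.mem_pi]

/-- A family of subgroups `𝓜 j` of an `S`-module is a grading for the purposes of resolutions if
forms of degree `j - i` map `𝓜 i` into `𝓜 j`. No direct sum decomposition is required. -/
def IsGrading (K : Type u) [Field K] (n : ℕ) {M : Type u} [AddCommGroup M]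
    [Module (MvPolynomial (Fin n) K) M]
    (𝓜 : ℕ → AddSubgroup M) : Prop :=
  ∀ ⦃i j : ℕ⦄ ⦃p : MvPolynomial (Fin n) K⦄ ⦃x : M⦄, p ∈ shiftGr K n i j → x ∈ 𝓜 i → p • x ∈ 𝓜 j

lemma isGrading_freeGr {ι : Type} (deg : ι → ℕ) : IsGrading K n (freeGr K n deg) := by
  intro i j p x hp hx
  rw [mem_freeGr] at hx ⊢
  exact fun b => mul_mem_shiftGr hp (hx b)

/-- The grading induced on a submodule. -/
noncomputable def subGr {M : Type u} [AddCommGroup M] [Module (MvPolynomial (Fin n) K) M]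
    (𝓜 : ℕ → AddSubgroup M) (N : Submodule (MvPolynomial (Fin n) K) M) (j : ℕ) : AddSubgroup N :=
  (𝓜 j).comap N.subtype.toAddMonoidHom

lemma mem_subGr {M : Type u} [AddCommGroup M] [Module (MvPolynomial (Fin n) K) M]
    {𝓜 : ℕ → AddSubgroup M} {N : Submodule (MvPolynomial (Fin n) K) M} {j : ℕ} {x : N} :
    x ∈ subGr 𝓜 N j ↔ (x : M) ∈ 𝓜 j := Iff.rfl

lemma IsGrading.subGr {M : Type u} [AddCommGroup M] [Module (MvPolynomial (Fin n) K) M]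
    {𝓜 : ℕ → AddSubgroup M} (h : IsGrading K n 𝓜) (N : Submodule (MvPolynomial (Fin n) K) M) :
    IsGrading K n (subGr 𝓜 N) := by
  intro i j p x hp hx
  exact h hp hx

lemma IsGrading.linearCombination_mem {M : Type u} [AddCommGroup M]
    [Module (MvPolynomial (Fin n) K) M] {𝓜 : ℕ → AddSubgroup M} (h : IsGrading K n 𝓜) {ι : Type}
    [Fintype ι] {deg : ι → ℕ} {v : ι → M} (hv : ∀ b, v b ∈ 𝓜 (deg b)) {j : ℕ}
    {x : ι → MvPolynomial (Fin n) K} (hx : x ∈ freeGr K n deg j) :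
    Fintype.linearCombination (MvPolynomial (Fin n) K) v x ∈ 𝓜 j := by
  rw [Fintype.linearCombination_apply]
  exact sum_mem fun b _ => h (mem_freeGr.1 hx b) (hv b)

/-! ### Graded free resolutions with prescribed degrees -/

/-- `M` has a graded free resolution, known up to homological degree `ℓ - 1`, in which the basis
elements in homological degree `i` have degrees `j` with `P i j`. The resolution is built one
syzygy module at a time; it need not be minimal. A cover is required to be
onto each `𝓜 j`; surjectivity onto `M` follows when the `𝓜 j` generate `M`. -/
def HasGradedResolution (K : Type u) [Field K] (n : ℕ) :
    ℕ → (ℕ → ℕ → Prop) → (M : Type u) → [AddCommGroup M] →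
    [Module (MvPolynomial (Fin n) K) M] → (ℕ → AddSubgroup M) → Prop
  | 0, _, _, _, _, _ => True
  | ℓ + 1, P, M, _, _, 𝓜 => ∃ (ι : Type) (_ : Fintype ι) (deg : ι → ℕ) (v : ι → M),
      (∀ b, P 0 (deg b)) ∧ (∀ b, v b ∈ 𝓜 (deg b)) ∧
      (∀ j, ∀ m ∈ 𝓜 j, ∃ x ∈ freeGr K n deg j,
        Fintype.linearCombination (MvPolynomial (Fin n) K) v x = m) ∧
      HasGradedResolution K n ℓ (fun i => P (i + 1))
        (LinearMap.ker (Fintype.linearCombination (MvPolynomial (Fin n) K) v))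
        (subGr (freeGr K n deg) _)

lemma HasGradedResolution.mono {ℓ : ℕ} {P Q : ℕ → ℕ → Prop} (hPQ : ∀ i j, P i j → Q i j)
    {M : Type u} [AddCommGroup M] [Module (MvPolynomial (Fin n) K) M] {𝓜 : ℕ → AddSubgroup M}
    (h : HasGradedResolution K n ℓ P M 𝓜) : HasGradedResolution K n ℓ Q M 𝓜 := by
  induction ℓ generalizing P Q M with
  | zero => trivial
  | succ ℓ ih =>
    obtain ⟨ι, _, deg, v, h1, h2, h4, h5⟩ := h
    exact ⟨ι, _, deg, v, fun b => hPQ _ _ (h1 b), h2, h4, ih (fun i => hPQ (i + 1)) h5⟩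

lemma HasGradedResolution.equiv {ℓ : ℕ} {P : ℕ → ℕ → Prop} {M M' : Type u} [AddCommGroup M]
    [Module (MvPolynomial (Fin n) K) M] [AddCommGroup M'] [Module (MvPolynomial (Fin n) K) M']
    {𝓜 : ℕ → AddSubgroup M} {𝓜' : ℕ → AddSubgroup M'} (e : M ≃ₗ[MvPolynomial (Fin n) K] M')
    (he : ∀ j x, x ∈ 𝓜 j ↔ e x ∈ 𝓜' j) (h : HasGradedResolution K n ℓ P M 𝓜) :
    HasGradedResolution K n ℓ P M' 𝓜' := by
  cases ℓ with
  | zero => trivial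
  | succ ℓ =>
    obtain ⟨ι, _, deg, v, h1, h2, h4, h5⟩ := h
    have hc : Fintype.linearCombination (MvPolynomial (Fin n) K) (fun b => e (v b)) =
        e.toLinearMap ∘ₗ Fintype.linearCombination (MvPolynomial (Fin n) K) v := by
      ext x
      simp [Fintype.linearCombination_apply]
    refine ⟨ι, inferInstance, deg, fun b => e (v b), h1, fun b => (he _ _).1 (h2 b), ?_, ?_⟩
    · intro j m hm
      obtain ⟨x, hx, hxm⟩ := h4 j (e.symm m) ((he _ _).2 (by simpa using hm))
      exact ⟨x, hx, by rw [hc]; simp [hxm]⟩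
    · rw [hc, LinearEquiv.ker_comp]
      exact h5

/-- The horseshoe lemma: the middle term of a short exact sequence of graded modules has a
resolution whose degrees come from resolutions of the outer terms. -/
lemma HasGradedResolution.horseshoe {ℓ : ℕ} {P : ℕ → ℕ → Prop} {M' M M'' : Type u}
    [AddCommGroup M'] [Module (MvPolynomial (Fin n) K) M'] [AddCommGroup M]
    [Module (MvPolynomial (Fin n) K) M] [AddCommGroup M''] [Module (MvPolynomial (Fin n) K) M'']
    {𝓜' : ℕ → AddSubgroup M'} {𝓜 : ℕ → AddSubgroup M} {𝓜'' : ℕ → AddSubgroup M''}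
    (hM : IsGrading K n 𝓜) (f : M' →ₗ[MvPolynomial (Fin n) K] M)
    (g : M →ₗ[MvPolynomial (Fin n) K] M'')
    (hf : Function.Injective f) (hfg : LinearMap.range f = LinearMap.ker g)
    (hf' : ∀ j x, x ∈ 𝓜' j ↔ f x ∈ 𝓜 j)
    (hg₁ : ∀ j, ∀ x ∈ 𝓜 j, g x ∈ 𝓜'' j) (hg₂ : ∀ j, ∀ y ∈ 𝓜'' j, ∃ x ∈ 𝓜 j, g x = y)
    (h' : HasGradedResolution K n ℓ P M' 𝓜') (h'' : HasGradedResolution K n ℓ P M'' 𝓜'') :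
    HasGradedResolution K n ℓ P M 𝓜 := by
  induction ℓ generalizing P M' M M'' with
  | zero => trivial
  | succ ℓ ih =>
    obtain ⟨ι', _, deg', v', h1', h2', h4', h5'⟩ := h'
    obtain ⟨ι'', _, deg'', v'', h1'', h2'', h4'', h5''⟩ := h''
    choose θ hθ₁ hθ₂ using fun b => hg₂ _ _ (h2'' b)
    have hgf : ∀ x, g (f x) = 0 := fun x => by
      have : f x ∈ LinearMap.ker g := hfg ▸ LinearMap.mem_range_self f x
      exact this
    set ε' := Fintype.linearCombination (MvPolynomial (Fin n) K) v' with hε'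
    set ε'' := Fintype.linearCombination (MvPolynomial (Fin n) K) v'' with hε''
    set η := Fintype.linearCombination (MvPolynomial (Fin n) K) θ with hη
    set w : ι' ⊕ ι'' → M := Sum.elim (fun b => f (v' b)) θ with hw
    set ε := Fintype.linearCombination (MvPolynomial (Fin n) K) w with hε
    have hε_apply : ∀ x, ε x = f (ε' (fun b => x (Sum.inl b))) + η (fun b => x (Sum.inr b)) := by
      intro x
      simp [hε, hε', hη, hw, Fintype.linearCombination_apply]
    have hgη : ∀ x, g (η x) = ε'' x := by
      intro x
      simp [hε'', hη, Fintype.linearCombination_apply, hθ₂]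
    have hgε : ∀ x, g (ε x) = ε'' (fun b => x (Sum.inr b)) := by
      intro x
      rw [hε_apply, map_add, hgf, zero_add, hgη]
    have hη_mem : ∀ j, ∀ x ∈ freeGr K n deg'' j, η x ∈ 𝓜 j :=
      fun j x hx => hM.linearCombination_mem hθ₁ hx
    have hker : ∀ m, g m = 0 → ∃ x, f x = m := fun m hm => by
      have : m ∈ LinearMap.range f := hfg ▸ hm
      exact this
    have elim_mem : ∀ j x' x'', x' ∈ freeGr K n deg' j → x'' ∈ freeGr K n deg'' j →
        Sum.elim x' x'' ∈ freeGr K n (Sum.elim deg' deg'') j := by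
      intro j x' x'' hx' hx''
      rw [mem_freeGr] at hx' hx'' ⊢
      rintro (b | b)
      · exact hx' b
      · exact hx'' b
    refine ⟨ι' ⊕ ι'', inferInstance, Sum.elim deg' deg'', w, ?_, ?_, ?_, ?_⟩
    · rintro (b | b)
      · exact h1' b
      · exact h1'' b
    · rintro (b | b)
      · exact (hf' _ _).1 (h2' b)
      · exact hθ₁ b
    · intro j m hm
      obtain ⟨x'', hx''m, hx''⟩ := h4'' j (g m) (hg₁ j m hm)
      obtain ⟨m', hm'⟩ := hker (m - η x'') (by rw [map_sub, hgη, hx'', sub_self])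
      have hm'j : m' ∈ 𝓜' j := by
        rw [hf', hm']
        exact sub_mem hm (hη_mem j _ hx''m)
      obtain ⟨x', hx'm, rfl⟩ := h4' j m' hm'j
      refine ⟨Sum.elim x' x'', elim_mem _ _ _ hx'm hx''m, ?_⟩
      rw [← hε, hε_apply]
      simp [hm']
    · let F : LinearMap.ker ε' →ₗ[MvPolynomial (Fin n) K] LinearMap.ker ε :=
        { toFun := fun x => ⟨Sum.elim x.1 0, by
            have : ε' x.1 = 0 := x.2
            simp only [LinearMap.mem_ker, hε_apply]
            have h0 : (fun b : ι'' => Sum.elim x.1 (0 : ι'' → MvPolynomial (Fin n) K)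
              (Sum.inr b)) = 0 := rfl
            rw [h0, map_zero, add_zero]
            exact (congrArg f this).trans (map_zero f)⟩
          map_add' := fun x y => by
            ext (b | b) <;> simp
          map_smul' := fun c x => by
            ext (b | b) <;> simp }
      let G : LinearMap.ker ε →ₗ[MvPolynomial (Fin n) K] LinearMap.ker ε'' :=
        { toFun := fun x => ⟨fun b => x.1 (Sum.inr b), by
            have : ε x.1 = 0 := x.2
            rw [LinearMap.mem_ker, ← hgε, this, map_zero]⟩
          map_add' := fun x y => rfl
          map_smul' := fun c x => rfl }
      have lift : ∀ y : LinearMap.ker ε'', ∃ m', f m' = - η y.1 := fun y => by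
        refine hker _ ?_
        have : ε'' y.1 = 0 := y.2
        rw [map_neg, hgη, this, neg_zero]
      have lift_mem : ∀ (y : LinearMap.ker ε'') (x' : ι' → MvPolynomial (Fin n) K),
          f (ε' x') = - η y.1 → Sum.elim x' y.1 ∈ LinearMap.ker ε := fun y x' hx' => by
        rw [LinearMap.mem_ker, hε_apply]
        simp only [Sum.elim_inl, Sum.elim_inr]
        rw [hx']
        exact neg_add_cancel _
      refine ih ((isGrading_freeGr _).subGr _) F G ?_ ?_ ?_ ?_ ?_ h5' h5''
      · intro x y hxy
        ext b : 2
        exact congrFun (congrArg Subtype.val hxy) (Sum.inl b)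
      · ext x
        constructor
        · rintro ⟨y, rfl⟩
          ext b : 2
          rfl
        · intro hx
          have hx0 : (fun b => x.1 (Sum.inr b)) = 0 := congrArg Subtype.val hx
          have hxε : ε x.1 = 0 := x.2
          rw [hε_apply, hx0, map_zero, add_zero] at hxε
          refine ⟨⟨fun b => x.1 (Sum.inl b), hf (hxε.trans (map_zero f).symm)⟩, ?_⟩
          ext (b | b) : 2
          · rfl
          · exact (congrFun hx0 b).symm
      · intro j x
        rw [mem_subGr, mem_subGr]
        constructor
        · exact fun hx => elim_mem j _ _ hx (zero_mem _)
        · intro hx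
          rw [mem_freeGr] at hx ⊢
          exact fun b => hx (Sum.inl b)
      · intro j x hx
        rw [mem_subGr, mem_freeGr] at hx ⊢
        exact fun b => hx (Sum.inr b)
      · intro j y hy
        obtain ⟨m', hm'⟩ := lift y
        obtain ⟨x', hx', rfl⟩ := h4' j m' (by
          rw [hf', hm']
          exact neg_mem (hη_mem j _ hy))
        exact ⟨⟨Sum.elim x' y.1, lift_mem y x' hm'⟩, elim_mem j _ _ hx' hy, rfl⟩

/-! ### Iterated colon ideals and linear quotients -/

lemma isGrading_shiftGr (a : ℕ) :
    IsGrading K n (M := MvPolynomial (Fin n) K) (shiftGr K n a) :=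
  fun _ _ _ _ hp hx => mul_mem_shiftGr hp hx

/-- The grading of `(S/L)(-a)` by images of forms. -/
noncomputable def quotGr (L : Ideal (MvPolynomial (Fin n) K)) (a j : ℕ) :
    AddSubgroup (MvPolynomial (Fin n) K ⧸ L) :=
  (shiftGr K n a j).map L.mkQ.toAddMonoidHom

/-- `I` contains the homogeneous components of its elements. -/
def IsComponentClosed (I : Ideal (MvPolynomial (Fin n) K)) : Prop :=
  ∀ f ∈ I, ∀ a j, shiftComp a j f ∈ I

lemma isComponentClosed_span {s : Set (MvPolynomial (Fin n) K)}
    (hs : ∀ w ∈ s, ∃ e, w.IsHomogeneous e) : IsComponentClosed (Ideal.span s) := by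
  suffices H : ∀ f ∈ Ideal.span s, ∀ p a j, shiftComp a j (p * f) ∈ Ideal.span s from
    fun f hf a j => by simpa using H f hf 1 a j
  intro f hf
  induction hf using Submodule.span_induction with
  | mem w hw =>
    intro p a j
    obtain ⟨e, he⟩ := hs w hw
    rw [← mem_shiftGr_zero, ← shiftGr_add (b := a), zero_add] at he
    rw [shiftComp_mul he]
    exact Ideal.mul_mem_left _ _ (Ideal.subset_span hw)
  | zero => simp
  | add x y _ _ hx hy =>
    intro p a j
    rw [mul_add, map_add]
    exact add_mem (hx p a j) (hy p a j)
  | smul q x _ hx =>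
    intro p a j
    rw [smul_eq_mul, ← mul_assoc]
    exact hx (p * q) a j

/-- A resolution of an ideal `L` gives one of `S/L`, by prefixing the cover `S → S/L`. -/
lemma HasGradedResolution.quotient {ℓ : ℕ} {P Q : ℕ → ℕ → Prop}
    {L : Ideal (MvPolynomial (Fin n) K)} {a : ℕ}
    (h : HasGradedResolution K n ℓ P L (subGr (shiftGr K n a) L))
    (hQ₀ : Q 0 a) (hQ : ∀ i j, P i j → Q (i + 1) j) :
    HasGradedResolution K n (ℓ + 1) Q (MvPolynomial (Fin n) K ⧸ L) (quotGr L a) := by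
  have hε : ∀ x : Unit → MvPolynomial (Fin n) K, Fintype.linearCombination (MvPolynomial (Fin n) K)
      (fun _ : Unit => L.mkQ 1) x = L.mkQ (x ()) := by
    intro x
    rw [Fintype.linearCombination_apply, Fintype.sum_unique, ← map_smul, smul_eq_mul, mul_one]
  refine ⟨Unit, inferInstance, fun _ => a, fun _ => L.mkQ 1, fun _ => hQ₀, fun _ => ?_, ?_, ?_⟩
  · exact ⟨1, one_mem_shiftGr a, rfl⟩
  · rintro j y ⟨f, hf, rfl⟩
    exact ⟨fun _ => f, mem_freeGr.2 fun _ => hf, hε _⟩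
  · have hker : ∀ x, x ∈ LinearMap.ker (Fintype.linearCombination (MvPolynomial (Fin n) K)
        (fun _ : Unit => L.mkQ 1)) ↔ x () ∈ L := by
      intro x
      rw [LinearMap.mem_ker, hε]
      exact Submodule.Quotient.mk_eq_zero L
    let e : L ≃ₗ[MvPolynomial (Fin n) K] LinearMap.ker (Fintype.linearCombination
        (MvPolynomial (Fin n) K) (fun _ : Unit => L.mkQ 1)) :=
      { toFun := fun f => ⟨fun _ => f.1, (hker _).2 f.2⟩
        invFun := fun x => ⟨x.1 (), (hker _).1 x.2⟩
        map_add' := fun _ _ => rfl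
        map_smul' := fun _ _ => rfl
        left_inv := fun _ => rfl
        right_inv := fun _ => rfl }
    refine (h.mono (fun i j => hQ i j)).equiv e ?_
    intro j x
    rw [mem_subGr, mem_subGr, mem_freeGr]
    exact ⟨fun hx _ => hx, fun hx => hx ()⟩

/-- The horseshoe lemma for `0 → I → I + (w) → (S/(I : w))(-e) → 0`, where `w` is a form of
degree `e`. -/
lemma HasGradedResolution.sup_span_singleton {ℓ : ℕ} {P : ℕ → ℕ → Prop}
    {I L : Ideal (MvPolynomial (Fin n) K)}
    (hI : IsComponentClosed I) {a e : ℕ} {w : MvPolynomial (Fin n) K}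
    (hw : w ∈ shiftGr K n a (a + e)) (hL : ∀ f, f * w ∈ I ↔ f ∈ L)
    (h₁ : HasGradedResolution K n ℓ P I (subGr (shiftGr K n a) I))
    (h₂ : HasGradedResolution K n ℓ P (MvPolynomial (Fin n) K ⧸ L) (quotGr L (a + e))) :
    HasGradedResolution K n ℓ P (I ⊔ Ideal.span {w} : Ideal (MvPolynomial (Fin n) K))
      (subGr (shiftGr K n a) _) := by
  set J : Ideal (MvPolynomial (Fin n) K) := I ⊔ Ideal.span {w} with hJ
  let q : J →ₗ[MvPolynomial (Fin n) K] MvPolynomial (Fin n) K ⧸ I := I.mkQ ∘ₗ J.subtype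
  let q' : (MvPolynomial (Fin n) K ⧸ L) →ₗ[MvPolynomial (Fin n) K] MvPolynomial (Fin n) K ⧸ I :=
    Submodule.mapQ L I (LinearMap.toSpanSingleton _ _ w) (fun f hf => (hL f).2 hf)
  have hq' : ∀ f, q' (L.mkQ f) = I.mkQ (f * w) := fun f => rfl
  have hq'inj : Function.Injective q' := by
    rw [← LinearMap.ker_eq_bot, LinearMap.ker_eq_bot']
    intro y hy
    obtain ⟨f, rfl⟩ := L.mkQ_surjective y
    rw [hq'] at hy
    exact (Submodule.Quotient.mk_eq_zero L).2 ((hL f).1 ((Submodule.Quotient.mk_eq_zero I).1 hy))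
  have hrange : ∀ x, q x ∈ LinearMap.range q' := by
    rintro ⟨x, hx⟩
    obtain ⟨y, hy, z, hz, rfl⟩ := Submodule.mem_sup.1 hx
    obtain ⟨f, rfl⟩ := Ideal.mem_span_singleton'.1 hz
    refine ⟨L.mkQ f, ?_⟩
    rw [hq']
    refine (Submodule.Quotient.eq I).2 ?_
    change f * w - (y + f * w) ∈ I
    rw [sub_add_cancel_right]
    exact I.neg_mem hy
  let g : J →ₗ[MvPolynomial (Fin n) K] MvPolynomial (Fin n) K ⧸ L :=
    (LinearEquiv.ofInjective q' hq'inj).symm.toLinearMap ∘ₗ q.codRestrict _ hrange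
  have hg : ∀ x, q' (g x) = q x := by
    intro x
    have := (LinearEquiv.ofInjective q' hq'inj).apply_symm_apply (q.codRestrict _ hrange x)
    exact congrArg Subtype.val this
  have hmem : ∀ f, f * w ∈ J := fun f =>
    (le_sup_right : Ideal.span {w} ≤ J) (Ideal.mem_span_singleton'.2 ⟨f, rfl⟩)
  refine HasGradedResolution.horseshoe ((isGrading_shiftGr a).subGr J)
    (Submodule.inclusion (le_sup_left : I ≤ J)) g (Submodule.inclusion_injective _) ?_ ?_ ?_ ?_
    h₁ h₂
  · rw [Submodule.range_inclusion]
    ext x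
    rw [Submodule.mem_comap, LinearMap.mem_ker, ← hq'inj.eq_iff, hg, map_zero]
    exact (Submodule.Quotient.mk_eq_zero I).symm
  · exact fun j x => Iff.rfl
  · intro j x hx
    obtain ⟨f, hf⟩ := L.mkQ_surjective (g x)
    -- the multiplier may be replaced by its component of the right degree
    refine ⟨shiftComp (a + e) j f, shiftComp_mem _ _ _, hq'inj ?_⟩
    have h1 : f * w - x.1 ∈ I := by
      have := hg x
      rw [← hf, hq'] at this
      exact (Submodule.Quotient.eq I).1 this
    have h2 := hI _ h1 a j
    rw [map_sub, shiftComp_mul hw, shiftComp_of_mem (mem_subGr.1 hx), if_pos rfl] at h2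
    rw [hg]
    exact (Submodule.Quotient.eq I).2 h2
  · rintro j y ⟨f, hf, rfl⟩
    refine ⟨⟨f * w, hmem f⟩, mul_mem_shiftGr hf hw, hq'inj ?_⟩
    rw [hg]
    rfl

lemma HasGradedResolution.bot {ℓ : ℕ} {P : ℕ → ℕ → Prop} (a : ℕ) :
    HasGradedResolution K n ℓ P (⊥ : Ideal (MvPolynomial (Fin n) K)) (subGr (shiftGr K n a) _) := by
  suffices H : ∀ (ℓ : ℕ) (P : ℕ → ℕ → Prop) (M : Type u) [AddCommGroup M]
      [Module (MvPolynomial (Fin n) K) M] (𝓜 : ℕ → AddSubgroup M), Subsingleton M →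
      HasGradedResolution K n ℓ P M 𝓜 from H _ _ _ _ inferInstance
  intro ℓ
  induction ℓ with
  | zero => intros; trivial
  | succ ℓ ih =>
    intro P M _ _ 𝓜 hM
    refine ⟨Empty, inferInstance, Empty.elim, Empty.elim, Empty.rec, Empty.rec,
      fun j m _ => ⟨0, zero_mem _, Subsingleton.elim _ _⟩, ih _ _ _ ?_⟩
    infer_instance

/-! ### Ideals generated by variables and by square-free monomials -/

/-- The prime ideal `(x_v : v ∈ V)`. -/
noncomputable def varIdeal (K : Type u) [Field K] {n : ℕ} (V : Finset (Fin n)) :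
    Ideal (MvPolynomial (Fin n) K) :=
  Ideal.span (X '' (V : Set (Fin n)))

lemma X_mem_varIdeal {V : Finset (Fin n)} {v : Fin n} (hv : v ∈ V) :
    (X v : MvPolynomial (Fin n) K) ∈ varIdeal K V :=
  Ideal.subset_span ⟨v, hv, rfl⟩

/-- Setting the variables in `V` to zero. -/
noncomputable def killVars (K : Type u) [Field K] {n : ℕ} (V : Finset (Fin n)) :
    MvPolynomial (Fin n) K →ₐ[K] MvPolynomial (Fin n) K :=
  aeval fun v => if v ∈ V then 0 else X v

lemma sub_killVars_mem (V : Finset (Fin n)) (f : MvPolynomial (Fin n) K) :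
    f - killVars K V f ∈ varIdeal K V := by
  have h : (Ideal.Quotient.mkₐ K (varIdeal K V)).comp (killVars K V) =
      Ideal.Quotient.mkₐ K (varIdeal K V) := by
    ext v
    simp only [AlgHom.comp_apply, killVars, aeval_X]
    split_ifs with hv
    · rw [map_zero]
      exact (Ideal.Quotient.eq_zero_iff_mem.2 (X_mem_varIdeal hv)).symm
    · rfl
  exact Ideal.Quotient.eq.1 (DFunLike.congr_fun h f).symm

lemma mem_varIdeal_iff_killVars {V : Finset (Fin n)} {f : MvPolynomial (Fin n) K} :
    f ∈ varIdeal K V ↔ killVars K V f = 0 := by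
  constructor
  · have : varIdeal K V ≤ RingHom.ker (killVars K V).toRingHom := by
      refine Ideal.span_le.2 ?_
      rintro _ ⟨v, hv, rfl⟩
      change killVars K V (X v) = 0
      rw [killVars, aeval_X, if_pos (Finset.mem_coe.1 hv)]
    exact fun hf => this hf
  · intro h
    simpa [h] using sub_killVars_mem V f

lemma isPrime_varIdeal (V : Finset (Fin n)) : (varIdeal K V).IsPrime := by
  have : varIdeal K V = RingHom.ker (killVars K V).toRingHom :=
    Ideal.ext fun f => mem_varIdeal_iff_killVars
  rw [this]
  exact RingHom.ker_isPrime _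

/-- The square-free monomial `∏_{v ∈ F} x_v`. -/
noncomputable def sqfree (K : Type u) [Field K] {n : ℕ} (F : Finset (Fin n)) :
    MvPolynomial (Fin n) K :=
  ∏ v ∈ F, X v

lemma sqfree_mem_shiftGr (F : Finset (Fin n)) (a : ℕ) :
    sqfree K F ∈ shiftGr K n a (a + F.card) := by
  rw [add_comm a, ← zero_add a, ← add_assoc, shiftGr_add, mem_shiftGr_zero]
  have := IsHomogeneous.prod F (fun v : Fin n => (X v : MvPolynomial (Fin n) K)) (fun _ => 1)
    (fun v _ => isHomogeneous_X K v)
  simpa [sqfree] using this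

lemma sqfree_ne_zero (F : Finset (Fin n)) : sqfree K F ≠ 0 :=
  Finset.prod_ne_zero_iff.2 fun v _ => X_ne_zero v

lemma sqfree_mem_varIdeal {F V : Finset (Fin n)} :
    sqfree K F ∈ varIdeal K V ↔ ∃ v ∈ F, v ∈ V := by
  rw [sqfree, (isPrime_varIdeal V).prod_mem_iff]
  refine exists_congr fun v => and_congr_right fun _ => ?_
  rw [mem_varIdeal_iff_killVars, killVars, aeval_X]
  split_ifs with h <;> simp [h]

/-- The ideal generated by the square-free monomials with supports in `𝓕`. -/
noncomputable def sqfreeIdeal (K : Type u) [Field K] {n : ℕ} (𝓕 : Set (Finset (Fin n))) :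
    Ideal (MvPolynomial (Fin n) K) :=
  Ideal.span (sqfree K '' 𝓕)

lemma sqfree_mem_sqfreeIdeal {𝓕 : Set (Finset (Fin n))} {F G : Finset (Fin n)} (hF : F ∈ 𝓕)
    (hFG : F ⊆ G) : sqfree K G ∈ sqfreeIdeal K 𝓕 :=
  Ideal.mem_of_dvd _ (Finset.prod_dvd_prod_of_subset _ _ _ hFG) (Ideal.subset_span ⟨F, hF, rfl⟩)

lemma isHomogeneous_sqfree (F : Finset (Fin n)) : (sqfree K F).IsHomogeneous F.card := by
  have := sqfree_mem_shiftGr (K := K) F 0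
  rwa [mem_shiftGr_zero, zero_add] at this

lemma isComponentClosed_sqfreeIdeal (𝓕 : Set (Finset (Fin n))) :
    IsComponentClosed (sqfreeIdeal K 𝓕) := by
  refine isComponentClosed_span ?_
  rintro _ ⟨F, _, rfl⟩
  exact ⟨F.card, isHomogeneous_sqfree F⟩

lemma varIdeal_eq_sqfreeIdeal (V : Finset (Fin n)) :
    varIdeal K V = sqfreeIdeal K ((fun v => {v}) '' (V : Set (Fin n))) := by
  rw [varIdeal, sqfreeIdeal, Set.image_image]
  simp [sqfree]

lemma sqfreeIdeal_insert (𝓕 : Set (Finset (Fin n))) (F : Finset (Fin n)) :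
    sqfreeIdeal K (insert F 𝓕) = sqfreeIdeal K 𝓕 ⊔ Ideal.span {sqfree K F} := by
  rw [sqfreeIdeal, Set.image_insert_eq, Ideal.span_insert, sup_comm]
  rfl

/-- The graded Koszul resolution of `(x_v : v ∈ V)`: it is concentrated in degrees `i + 1` and has
length at most `|V| - 1`. -/
lemma hasGradedResolution_varIdeal (V : Finset (Fin n)) (ℓ a : ℕ) :
    HasGradedResolution K n ℓ (fun i j => j = i + 1 + a ∧ i + 1 ≤ V.card) (varIdeal K V)
      (subGr (shiftGr K n a) _) := by
  classical
  induction V using Finset.induction_on generalizing ℓ a with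
  | empty =>
    have : varIdeal K (∅ : Finset (Fin n)) = ⊥ := by simp [varIdeal]
    rw [this]
    exact HasGradedResolution.bot a
  | insert v V hv ih =>
    have h1 : varIdeal K (insert v V) = varIdeal K V ⊔ Ideal.span {sqfree K {v}} := by
      rw [varIdeal_eq_sqfreeIdeal, varIdeal_eq_sqfreeIdeal, ← sqfreeIdeal_insert,
        Finset.coe_insert, Set.image_insert_eq]
    have h2 : IsComponentClosed (varIdeal K V) := by
      rw [varIdeal_eq_sqfreeIdeal]
      exact isComponentClosed_sqfreeIdeal _
    rw [h1, Finset.card_insert_of_notMem hv]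
    refine HasGradedResolution.sup_span_singleton (L := varIdeal K V) h2
      (sqfree_mem_shiftGr {v} a) ?_ ((ih ℓ a).mono ?_) ?_
    · intro f
      rw [(isPrime_varIdeal V).mul_mem_iff_mem_or_mem, or_iff_left]
      simpa [sqfree_mem_varIdeal] using hv
    · rintro i j ⟨rfl, h⟩
      exact ⟨rfl, by omega⟩
    · cases ℓ with
      | zero => trivial
      | succ ℓ =>
        refine (ih ℓ _).quotient ⟨?_, by omega⟩ ?_
        · simp [add_comm]
        · rintro i j ⟨rfl, h⟩
          rw [Finset.card_singleton]
          exact ⟨by omega, by omega⟩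

/-- One step of a resolution by linear quotients: if the colon ideal of the generators so far with
`∏_{v ∈ F} x_v` is `(x_v : v ∈ V)`, then the new generator contributes a Koszul complex in
degrees `i + |F|`, `i ≤ |V|`. The primality of `(x_v : v ∈ V)` reduces the
computation of the colon ideal to the two combinatorial conditions `hV₁` and `hV₂`. -/
lemma HasGradedResolution.sqfreeIdeal_insert {ℓ : ℕ} {P : ℕ → ℕ → Prop}
    {𝓕 : Set (Finset (Fin n))} {F V : Finset (Fin n)} (hFV : Disjoint F V)
    (hV₁ : ∀ v ∈ V, ∃ G ∈ 𝓕, G ⊆ insert v F) (hV₂ : ∀ G ∈ 𝓕, ∃ v ∈ G, v ∈ V)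
    (hP : ∀ i ≤ V.card, P i (i + F.card))
    (h : HasGradedResolution K n ℓ P (sqfreeIdeal K 𝓕) (subGr (shiftGr K n 0) _)) :
    HasGradedResolution K n ℓ P (sqfreeIdeal K (insert F 𝓕)) (subGr (shiftGr K n 0) _) := by
  rw [StanleyReisner.sqfreeIdeal_insert]
  refine HasGradedResolution.sup_span_singleton (L := varIdeal K V)
    (isComponentClosed_sqfreeIdeal 𝓕) (sqfree_mem_shiftGr F 0) ?_ h ?_
  · intro f
    constructor
    · intro hf
      have h1 : sqfreeIdeal K 𝓕 ≤ varIdeal K V := by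
        refine Ideal.span_le.2 ?_
        rintro _ ⟨G, hG, rfl⟩
        exact sqfree_mem_varIdeal.2 (hV₂ G hG)
      refine ((isPrime_varIdeal V).mem_or_mem (h1 hf)).resolve_right ?_
      rw [sqfree_mem_varIdeal]
      rintro ⟨v, hvF, hvV⟩
      exact Finset.disjoint_left.1 hFV hvF hvV
    · intro hf
      have h1 : varIdeal K V ≤ Submodule.comap
          (LinearMap.toSpanSingleton (MvPolynomial (Fin n) K) _ (sqfree K F))
          (sqfreeIdeal K 𝓕) := by
        refine Submodule.span_le.2 ?_
        rintro _ ⟨v, hv, rfl⟩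
        obtain ⟨G, hG, hGF⟩ := hV₁ v hv
        have hvF : v ∉ F := Finset.disjoint_right.1 hFV hv
        have := sqfree_mem_sqfreeIdeal (K := K) hG hGF
        rwa [sqfree, Finset.prod_insert hvF] at this
      exact h1 hf
  · cases ℓ with
    | zero => trivial
    | succ ℓ =>
      refine (hasGradedResolution_varIdeal V ℓ _).quotient ?_ ?_
      · exact hP 0 (Nat.zero_le _)
      · rintro i j ⟨rfl, hi⟩
        have := hP (i + 1) hi
        rwa [zero_add]

/-! ### Comparison with a minimal resolution -/

lemma exists_comp_eq_of_range_le {R : Type*} [CommRing R] {P B A : Type*} [AddCommGroup P]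
    [Module R P] [Module.Projective R P] [AddCommGroup B] [Module R B] [AddCommGroup A] [Module R A]
    (ε : B →ₗ[R] A) (γ : P →ₗ[R] A) (h : LinearMap.range γ ≤ LinearMap.range ε) :
    ∃ β : P →ₗ[R] B, ε ∘ₗ β = γ := by
  obtain ⟨β, hβ⟩ := Module.projective_lifting_property ε.rangeRestrict
    (γ.codRestrict (LinearMap.range ε) fun x => h ⟨x, rfl⟩) ε.surjective_rangeRestrict
  refine ⟨β, ?_⟩
  ext x
  exact congrArg Subtype.val (DFunLike.congr_fun hβ x)

lemma linearMap_apply_eq_sum {R : Type*} [CommRing R] {A ι : Type*} [AddCommGroup A] [Module R A]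
    [Fintype ι] [DecidableEq ι] (L : (ι → R) →ₗ[R] A) (x : ι → R) :
    L x = ∑ b, x b • L (Pi.single b 1) := by
  conv_lhs => rw [pi_eq_sum_univ' x]
  simp

lemma constantCoeff_linearMap_apply {ι κ : Type*} [Fintype ι] [DecidableEq ι]
    (L : (ι → MvPolynomial (Fin n) K) →ₗ[MvPolynomial (Fin n) K] (κ → MvPolynomial (Fin n) K))
    (x : ι → MvPolynomial (Fin n) K) (c : κ) :
    constantCoeff (L x c) = ∑ b, constantCoeff (x b) * constantCoeff (L (Pi.single b 1) c) := by
  rw [linearMap_apply_eq_sum L x, Finset.sum_apply, map_sum]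
  simp

/-- The inductive step of the comparison of a minimal resolution, one of whose maps is `ε`, with a
graded cover `⨁_c S(-deg' c) → M` given by `v`. The maps `a` and `g` compare the image of `ε`
with `M`, and `u` exhibits `1 - g a` as a map that vanishes modulo the variables. The lifts `α`
of `a` and `β` of `g` then compose to the identity modulo the variables, and since `α` preserves
degrees, every degree of the minimal resolution occurs among the `deg' c`. -/
lemma comparison_step {ι ι' : Type} [Fintype ι] [DecidableEq ι] [Fintype ι']
    {deg : ι → ℕ} {deg' : ι' → ℕ} {A M : Type u} [AddCommGroup A]
    [Module (MvPolynomial (Fin n) K) A] [AddCommGroup M] [Module (MvPolynomial (Fin n) K) M]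
    {𝓜 : ℕ → AddSubgroup M} {v : ι' → M}
    (hv' : ∀ j, ∀ m ∈ 𝓜 j, ∃ x ∈ freeGr K n deg' j,
      Fintype.linearCombination (MvPolynomial (Fin n) K) v x = m)
    (ε : (ι → MvPolynomial (Fin n) K) →ₗ[MvPolynomial (Fin n) K] A)
    (hmin : ∀ x, ε x = 0 → ∀ b, constantCoeff (x b) = 0)
    (a : (ι → MvPolynomial (Fin n) K) →ₗ[MvPolynomial (Fin n) K] M)
    (ha : ∀ b, a (Pi.single b 1) ∈ 𝓜 (deg b))
    (g : M →ₗ[MvPolynomial (Fin n) K] A) (hg : LinearMap.range g ≤ LinearMap.range ε)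
    (u : (ι → MvPolynomial (Fin n) K) →ₗ[MvPolynomial (Fin n) K] (ι → MvPolynomial (Fin n) K))
    (hu : ∀ x b, constantCoeff (u x b) = 0) (hεu : ∀ x, ε (u x) = ε x - g (a x)) :
    ∃ (α : (ι → MvPolynomial (Fin n) K) →ₗ[MvPolynomial (Fin n) K] (ι' → MvPolynomial (Fin n) K))
      (β : (ι' → MvPolynomial (Fin n) K) →ₗ[MvPolynomial (Fin n) K] (ι → MvPolynomial (Fin n) K)),
      (∀ b, α (Pi.single b 1) ∈ freeGr K n deg' (deg b)) ∧
      (∀ x, Fintype.linearCombination (MvPolynomial (Fin n) K) v (α x) = a x) ∧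
      (∀ y, ε (β y) = g (Fintype.linearCombination (MvPolynomial (Fin n) K) v y)) ∧
      ∀ b, ∃ c, deg' c = deg b := by
  classical
  set π := Fintype.linearCombination (MvPolynomial (Fin n) K) v with hπ
  choose α₀ hα₀ hα₀' using fun b => hv' _ _ (ha b)
  let α := Fintype.linearCombination (MvPolynomial (Fin n) K) α₀
  have hα_single : ∀ b, α (Pi.single b 1) = α₀ b := fun b => by
    simp [α]
  have hα : ∀ x, π (α x) = a x := by
    intro x
    rw [← LinearMap.comp_apply, linearMap_apply_eq_sum (π ∘ₗ α) x, linearMap_apply_eq_sum a x]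
    simp only [LinearMap.comp_apply, hα_single, hα₀']
  obtain ⟨β, hβ⟩ := exists_comp_eq_of_range_le ε (g ∘ₗ π)
    ((LinearMap.range_comp_le_range π g).trans hg)
  have hβ' : ∀ y, ε (β y) = g (π y) := fun y => DFunLike.congr_fun hβ y
  refine ⟨α, β, fun b => by rw [hα_single]; exact hα₀ b, hα, hβ', fun b => ?_⟩
  have h1 : ε (Pi.single b 1 - u (Pi.single b 1) - β (α (Pi.single b 1))) = 0 := by
    rw [map_sub, map_sub, hεu, hβ', hα]
    abel
  have h2 := hmin _ h1 b
  simp only [Pi.sub_apply, map_sub, Pi.single_eq_same, map_one, hu, sub_zero] at h2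
  rw [constantCoeff_linearMap_apply β, hα_single] at h2
  have h3 : ∑ c, constantCoeff (α₀ b c) * constantCoeff (β (Pi.single c 1) b) ≠ 0 := by
    rw [← sub_eq_zero.1 h2]
    exact one_ne_zero
  obtain ⟨c, -, hc⟩ := Finset.exists_ne_zero_of_sum_ne_zero h3
  have := mem_freeGr.1 (hα₀ b) c 0 (left_ne_zero_of_mul hc)
  exact ⟨c, by simpa using this⟩

namespace MinimalGradedFreeResolution

variable {I : Ideal (MvPolynomial (Fin n) K)} (F : MinimalGradedFreeResolution I)

lemma d_single_mem_freeGr (i : ℕ) (b : Fin (F.rank (i + 1))) :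
    F.d i (Pi.single b 1) ∈ freeGr K n (F.deg i) (F.deg (i + 1) b) :=
  mem_freeGr.2 fun c m hm => F.d_homogeneous i b c m (mem_support_iff.2 hm)

/-- Iteration of `comparison_step` along a minimal resolution, from homological degree `i` to
`i + k`. If `h` is a lift of `1 - u - β α` along the differential `d`, the data `a`, `g`, `u` pass
to the next syzygies as `α d`, `β` and `h d`; the last vanishes modulo the variables because `d`
does. -/
lemma comparison_induction (k : ℕ) :
    ∀ {P : ℕ → ℕ → Prop} {i : ℕ} {A M : Type u} [AddCommGroup A]
    [Module (MvPolynomial (Fin n) K) A] [AddCommGroup M] [Module (MvPolynomial (Fin n) K) M]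
    {𝓜 : ℕ → AddSubgroup M} (_ : HasGradedResolution K n (k + 1) P M 𝓜)
    (ε : (Fin (F.rank i) → MvPolynomial (Fin n) K) →ₗ[MvPolynomial (Fin n) K] A)
    (_ : LinearMap.range (F.d i) = LinearMap.ker ε)
    (a : (Fin (F.rank i) → MvPolynomial (Fin n) K) →ₗ[MvPolynomial (Fin n) K] M)
    (_ : ∀ b, a (Pi.single b 1) ∈ 𝓜 (F.deg i b)) (_ : LinearMap.ker ε ≤ LinearMap.ker a)
    (g : M →ₗ[MvPolynomial (Fin n) K] A) (_ : LinearMap.range g ≤ LinearMap.range ε)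
    (u : (Fin (F.rank i) → MvPolynomial (Fin n) K) →ₗ[MvPolynomial (Fin n) K]
      (Fin (F.rank i) → MvPolynomial (Fin n) K)) (_ : LinearMap.ker ε ≤ LinearMap.ker u)
    (_ : ∀ x b, constantCoeff (u x b) = 0) (_ : ∀ x, ε (u x) = ε x - g (a x))
    (i' : ℕ) (_ : i' = i + k) (b : Fin (F.rank i')), P k (F.deg i' b) := by
  induction k with
  | zero =>
    intro P i A M _ _ _ _ 𝓜 hM ε hε a ha hεa g hg u hεu hu hu' i' hi' b
    obtain ⟨ι, _, deg, v, h1, -, h4, h5⟩ := hM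
    have hmin : ∀ x, ε x = 0 → ∀ b, constantCoeff (x b) = 0 := by
      intro x hx b
      obtain ⟨y, rfl⟩ : x ∈ LinearMap.range (F.d i) := hε ▸ hx
      exact F.minimal i y b
    obtain rfl : i' = i := hi'
    obtain ⟨-, -, -, -, -, h⟩ := comparison_step h4 ε hmin a ha g hg u hu hu'
    obtain ⟨c, hc⟩ := h b
    exact hc ▸ h1 c
  | succ k ih =>
    intro P i A M _ _ _ _ 𝓜 hM ε hε a ha hεa g hg u hεu hu hu' i' hi' b
    obtain ⟨ι, _, deg, v, h1, -, h4, h5⟩ := hM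
    have hmin : ∀ x, ε x = 0 → ∀ b, constantCoeff (x b) = 0 := by
      intro x hx b
      obtain ⟨y, rfl⟩ : x ∈ LinearMap.range (F.d i) := hε ▸ hx
      exact F.minimal i y b
    obtain ⟨α, β, hα₁, hα₂, hβ, -⟩ := comparison_step h4 ε hmin a ha g hg u hu hu'
    set π := Fintype.linearCombination (MvPolynomial (Fin n) K) v with hπ
    have hεd : ∀ x, ε (F.d i x) = 0 := fun x => by
      have : F.d i x ∈ LinearMap.ker ε := hε ▸ LinearMap.mem_range_self _ x
      exact this
    have had : ∀ x, a (F.d i x) = 0 := fun x => hεa (hεd x)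
    have hud : ∀ x, u (F.d i x) = 0 := fun x => hεu (hεd x)
    have hα₃ : ∀ j, ∀ x ∈ freeGr K n (F.deg i) j, α x ∈ freeGr K n deg j := by
      intro j x hx
      rw [linearMap_apply_eq_sum α x]
      exact sum_mem fun c _ => isGrading_freeGr deg (mem_freeGr.1 hx c) (hα₁ c)
    -- the homotopy `1 - u - β α`, whose values are cycles
    obtain ⟨h, hh⟩ := exists_comp_eq_of_range_le (F.d i) (LinearMap.id - u - β ∘ₗ α) (by
      rintro _ ⟨x, rfl⟩
      rw [hε, LinearMap.mem_ker]
      simp only [LinearMap.sub_apply, LinearMap.id_apply, LinearMap.comp_apply, map_sub, hu', hβ,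
        hα₂]
      abel)
    have hh' : ∀ x, F.d i (h x) = x - u x - β (α x) := fun x => DFunLike.congr_fun hh x
    have had' : ∀ x, (α ∘ₗ F.d i) x ∈ LinearMap.ker π := fun x => by
      rw [LinearMap.mem_ker, LinearMap.comp_apply, hα₂, had]
    refine ih (P := fun i => P (i + 1)) h5 (F.d i) (F.exact_succ i)
      ((α ∘ₗ F.d i).codRestrict _ had') ?_ ?_ (β ∘ₗ (LinearMap.ker π).subtype) ?_ (h ∘ₗ F.d i)
      ?_ ?_ ?_ i' (by omega) b
    · intro b
      exact hα₃ _ _ (F.d_single_mem_freeGr i b)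
    · intro x hx
      have hx0 : F.d i x = 0 := hx
      rw [LinearMap.mem_ker]
      refine Subtype.ext ?_
      change α (F.d i x) = 0
      rw [hx0, map_zero]
    · rintro _ ⟨y, rfl⟩
      have hy : π y.1 = 0 := y.2
      rw [hε, LinearMap.mem_ker]
      change ε (β y.1) = 0
      rw [hβ]
      exact (congrArg g hy).trans (map_zero g)
    · intro x hx
      have hx0 : F.d i x = 0 := hx
      rw [LinearMap.mem_ker, LinearMap.comp_apply, hx0, map_zero]
    · intro x b
      rw [LinearMap.comp_apply, constantCoeff_linearMap_apply h]
      exact Finset.sum_eq_zero fun c _ => by rw [F.minimal, zero_mul]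
    · intro x
      rw [LinearMap.comp_apply, hh', hud, sub_zero]
      rfl

/-- The degrees of a minimal graded free resolution occur in every graded free resolution. -/
theorem deg_of_hasGradedResolution {P : ℕ → ℕ → Prop}
    (h : ∀ ℓ, HasGradedResolution K n ℓ P I (subGr (shiftGr K n 0) I)) (i : ℕ)
    (b : Fin (F.rank i)) : P i (F.deg i b) := by
  have hI : ∀ x, F.aug x ∈ I := fun x => by
    have := LinearMap.mem_range_self F.aug x
    rwa [F.range_aug] at this
  refine F.comparison_induction i (h (i + 1)) F.aug F.exact_zero
    (F.aug.codRestrict I hI) ?_ ?_ (Submodule.subtype I) ?_ 0 ?_ ?_ ?_ i (zero_add i).symm b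
  · intro b
    exact mem_shiftGr_zero.2 (F.aug_homogeneous b)
  · intro x hx
    exact Subtype.ext hx
  · rw [F.range_aug, Submodule.range_subtype]
  · exact fun x _ => rfl
  · intro x b
    exact map_zero _
  · intro x
    rw [LinearMap.zero_apply, map_zero]
    exact (sub_self _).symm

end MinimalGradedFreeResolution

/-! ### Existence of minimal graded free resolutions -/

/-- The component of degree `j` of an element of `⨁_b S(-deg b)`. -/
noncomputable def freeComp {ι : Type} (deg : ι → ℕ) (j : ℕ) :
    (ι → MvPolynomial (Fin n) K) →+ (ι → MvPolynomial (Fin n) K) where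
  toFun x b := shiftComp (deg b) j (x b)
  map_zero' := by ext b : 1; simp
  map_add' x y := by ext b : 1; simp

lemma freeComp_apply {ι : Type} (deg : ι → ℕ) (j : ℕ) (x : ι → MvPolynomial (Fin n) K) (b : ι) :
    freeComp deg j x b = shiftComp (deg b) j (x b) := rfl

lemma freeComp_mem {ι : Type} (deg : ι → ℕ) (j : ℕ) (x : ι → MvPolynomial (Fin n) K) :
    freeComp deg j x ∈ freeGr K n deg j :=
  mem_freeGr.2 fun _ => shiftComp_mem _ _ _

lemma freeComp_linearCombination {ι κ : Type} [Fintype κ] {deg : ι → ℕ} {deg' : κ → ℕ}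
    {v : κ → ι → MvPolynomial (Fin n) K} (hv : ∀ c, v c ∈ freeGr K n deg (deg' c)) (j : ℕ)
    (x : κ → MvPolynomial (Fin n) K) :
    freeComp deg j (Fintype.linearCombination (MvPolynomial (Fin n) K) v x) =
      Fintype.linearCombination (MvPolynomial (Fin n) K) v (freeComp deg' j x) := by
  rw [Fintype.linearCombination_apply, Fintype.linearCombination_apply, map_sum]
  refine Finset.sum_congr rfl fun c _ => ?_
  ext b : 1
  exact shiftComp_mul (mem_freeGr.1 (hv c) b) j (x c)

lemma sum_freeComp {ι : Type} [Fintype ι] (deg : ι → ℕ) (x : ι → MvPolynomial (Fin n) K) :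
    ∃ B, ∑ j ∈ Finset.range B, freeComp deg j x = x := by
  refine ⟨(Finset.univ.sup fun b => (x b).totalDegree + deg b) + 1, ?_⟩
  ext b m
  rw [Finset.sum_apply, coeff_sum]
  simp only [freeComp_apply, coeff_shiftComp, Finset.sum_ite_eq, Finset.mem_range]
  refine ite_eq_left_iff.2 fun h => ?_
  by_contra hne
  have h1 : m.degree ≤ (x b).totalDegree := le_totalDegree (mem_support_iff.2 (Ne.symm hne))
  have h2 := Finset.le_sup (f := fun b => (x b).totalDegree + deg b) (Finset.mem_univ b)
  omega

lemma shiftComp_self (a : ℕ) (f : MvPolynomial (Fin n) K) :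
    shiftComp a a f = C (constantCoeff f) := by
  ext m
  rw [coeff_shiftComp, coeff_C]
  have : m.degree + a = a ↔ 0 = m := by
    rw [add_eq_right, Finsupp.degree_eq_zero_iff, eq_comm]
  simp only [this]
  split_ifs with h
  · rw [← h]
    rfl
  · rfl

/-- A homogeneous submodule of a free module has a minimal system of homogeneous generators: for
a homogeneous system with the fewest elements, no relation has a unit as a coefficient. -/
lemma exists_minimal_cover {ι : Type} [Fintype ι] (deg : ι → ℕ)
    (N : Submodule (MvPolynomial (Fin n) K) (ι → MvPolynomial (Fin n) K))
    (hN : ∀ x ∈ N, ∀ j, freeComp deg j x ∈ N) :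
    ∃ (r : ℕ) (deg' : Fin r → ℕ) (v : Fin r → ι → MvPolynomial (Fin n) K),
      (∀ b, v b ∈ freeGr K n deg (deg' b)) ∧
      LinearMap.range (Fintype.linearCombination (MvPolynomial (Fin n) K) v) = N ∧
      ∀ x, Fintype.linearCombination (MvPolynomial (Fin n) K) v x = 0 →
        ∀ b, constantCoeff (x b) = 0 := by
  classical
  set T : Set (ι → MvPolynomial (Fin n) K) := {x | x ∈ N ∧ ∃ j, x ∈ freeGr K n deg j} with hT
  have hTN : Submodule.span (MvPolynomial (Fin n) K) T = N := by
    refine le_antisymm (Submodule.span_le.2 fun x hx => hx.1) fun x hx => ?_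
    obtain ⟨B, hB⟩ := sum_freeComp deg x
    rw [← hB]
    exact sum_mem fun j _ => Submodule.subset_span ⟨hN x hx j, j, freeComp_mem deg j x⟩
  have hex : ∃ k, ∃ s : Finset (ι → MvPolynomial (Fin n) K), s.card = k ∧ ↑s ⊆ T ∧
      Submodule.span (MvPolynomial (Fin n) K) (s : Set (ι → MvPolynomial (Fin n) K)) = N := by
    have hfg : (Submodule.span (MvPolynomial (Fin n) K) T).FG := IsNoetherian.noetherian _
    obtain ⟨s, hs, hs'⟩ := Submodule.fg_span_iff_fg_span_finset_subset T |>.1 hfg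
    exact ⟨s.card, s, rfl, hs, by rw [← hs', hTN]⟩
  obtain ⟨s, hcard, hsT, hsN⟩ := Nat.find_spec hex
  choose dg hdg using fun x : s => (hsT x.2).2
  let v : Fin s.card → ι → MvPolynomial (Fin n) K := fun b => (s.equivFin.symm b).1
  have hv : ∀ b, v b ∈ freeGr K n deg (dg (s.equivFin.symm b)) := fun b => hdg _
  have hv_inj : Function.Injective v := Subtype.val_injective.comp s.equivFin.symm.injective
  have hv_mem : ∀ b, v b ∈ s := fun b => (s.equivFin.symm b).2
  refine ⟨s.card, fun b => dg (s.equivFin.symm b), v, hv, ?_, ?_⟩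
  · rw [Fintype.range_linearCombination, ← hsN]
    congr 1
    ext x
    constructor
    · rintro ⟨b, rfl⟩
      exact hv_mem b
    · intro hx
      exact ⟨s.equivFin ⟨x, hx⟩, by simp [v]⟩
  · intro x hx c
    by_contra hne
    have h1 := congrArg (freeComp deg (dg (s.equivFin.symm c))) hx
    rw [freeComp_linearCombination hv, map_zero, Fintype.linearCombination_apply,
      ← Finset.add_sum_erase _ _ (Finset.mem_univ c), freeComp_apply, shiftComp_self] at h1
    have h2 : v c ∈ Submodule.span (MvPolynomial (Fin n) K)
        (s.erase (v c) : Set (ι → MvPolynomial (Fin n) K)) := by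
      have h3 : (C (constantCoeff (x c)) : MvPolynomial (Fin n) K) • v c ∈
          Submodule.span (MvPolynomial (Fin n) K)
            (s.erase (v c) : Set (ι → MvPolynomial (Fin n) K)) := by
        rw [eq_neg_of_add_eq_zero_left h1]
        refine neg_mem (sum_mem fun b hb => Submodule.smul_mem _ _ (Submodule.subset_span ?_))
        rw [Finset.mem_coe, Finset.mem_erase]
        exact ⟨hv_inj.ne (Finset.ne_of_mem_erase hb), hv_mem b⟩
      have h4 := Submodule.smul_mem _ (C (constantCoeff (x c))⁻¹ : MvPolynomial (Fin n) K) h3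
      rwa [smul_smul, ← C_mul, inv_mul_cancel₀ hne, C_1, one_smul] at h4
    refine Nat.find_min hex (m := (s.erase (v c)).card) ?_ ⟨_, rfl, ?_, ?_⟩
    · rw [← hcard]
      exact Finset.card_erase_lt_of_mem (hv_mem c)
    · exact fun y hy => hsT (Finset.mem_of_mem_erase hy)
    · rw [← hsN]
      refine le_antisymm (Submodule.span_mono (Finset.coe_subset.2 (Finset.erase_subset _ _)))
        (Submodule.span_le.2 fun y hy => ?_)
      by_cases hyc : y = v c
      · rw [hyc]
        exact h2
      · exact Submodule.subset_span (Finset.mem_coe.2 (Finset.mem_erase.2 ⟨hyc, hy⟩))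

/-- A homogeneous submodule of a graded free module of finite rank. -/
structure HomogeneousSyzygy (K : Type u) [Field K] (n : ℕ) where
  /-- the rank of the ambient free module -/
  rank : ℕ
  /-- the degrees of its basis elements -/
  deg : Fin rank → ℕ
  /-- the submodule -/
  submodule : Submodule (MvPolynomial (Fin n) K) (Fin rank → MvPolynomial (Fin n) K)
  /-- the submodule is homogeneous -/
  freeComp_mem : ∀ x ∈ submodule, ∀ j, freeComp deg j x ∈ submodule

/-- One step of the construction of a minimal resolution: a minimal cover of a syzygy module, with
its kernel as the next syzygy module. -/
lemma HomogeneousSyzygy.exists_next (N : HomogeneousSyzygy K n) :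
    ∃ (N' : HomogeneousSyzygy K n) (φ : (Fin N'.rank → MvPolynomial (Fin n) K)
      →ₗ[MvPolynomial (Fin n) K] (Fin N.rank → MvPolynomial (Fin n) K)),
      (∀ b, φ (Pi.single b 1) ∈ freeGr K n N.deg (N'.deg b)) ∧
      LinearMap.range φ = N.submodule ∧ LinearMap.ker φ = N'.submodule ∧
      ∀ x, φ x = 0 → ∀ b, constantCoeff (x b) = 0 := by
  obtain ⟨r, deg', v, h1, h2, h3⟩ := exists_minimal_cover N.deg N.submodule N.freeComp_mem
  refine ⟨⟨r, deg', LinearMap.ker (Fintype.linearCombination (MvPolynomial (Fin n) K) v), ?_⟩,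
    Fintype.linearCombination (MvPolynomial (Fin n) K) v, ?_, h2, rfl, h3⟩
  · intro x hx j
    rw [LinearMap.mem_ker] at hx ⊢
    rw [← freeComp_linearCombination h1, hx, map_zero]
  · intro b
    simpa using h1 b

theorem MinimalGradedFreeResolution.nonempty {I : Ideal (MvPolynomial (Fin n) K)}
    (hI : IsComponentClosed I) : Nonempty (MinimalGradedFreeResolution I) := by
  choose next φ h₁ h₂ h₃ h₄ using HomogeneousSyzygy.exists_next (K := K) (n := n)
  let N₀ : HomogeneousSyzygy K n :=
    { rank := 1
      deg := fun _ => 0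
      submodule := Submodule.comap (LinearMap.proj 0) I
      freeComp_mem := fun x hx j => hI _ hx 0 j }
  let N : ℕ → HomogeneousSyzygy K n := fun i => Nat.rec N₀ (fun _ M => next M) i
  have hproj : Function.Injective
      (LinearMap.proj 0 : (Fin 1 → MvPolynomial (Fin n) K) →ₗ[MvPolynomial (Fin n) K] _) := by
    intro x y hxy
    ext b : 1
    rw [Subsingleton.elim b 0]
    exact hxy
  exact ⟨{
    rank := fun i => (N (i + 1)).rank
    deg := fun i => (N (i + 1)).deg
    aug := LinearMap.proj 0 ∘ₗ φ N₀
    d := fun i => φ (N (i + 1))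
    aug_homogeneous := fun b => mem_shiftGr_zero.1 (mem_freeGr.1 (h₁ N₀ b) 0)
    d_homogeneous := fun i b c m hm =>
      mem_freeGr.1 (h₁ (N (i + 1)) b) c m (mem_support_iff.1 hm)
    range_aug := by
      rw [LinearMap.range_comp, h₂]
      exact Submodule.map_comap_eq_of_surjective (fun f => ⟨fun _ => f, rfl⟩) I
    exact_zero := by
      rw [LinearMap.ker_comp_of_ker_eq_bot _ (LinearMap.ker_eq_bot.2 hproj), h₂, h₃]
      rfl
    exact_succ := fun i => by rw [h₂, h₃]
    minimal := fun i x c => by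
      have h : φ (N (i + 1)) x ∈ LinearMap.range (φ (N (i + 1))) := LinearMap.mem_range_self _ _
      rw [h₂] at h
      refine h₄ (N i) _ ?_ c
      have h' := h₃ (N i)
      exact LinearMap.mem_ker.1 (h'.symm ▸ h) }⟩

/-! ### Linear quotients of the Stanley-Reisner ideal -/

/-- The square-free Veronese ideal generated by all square-free monomials of degree `k + 1` has
linear quotients in the colexicographic order: the colon ideal at `F` is generated by the `x_v` with
`v ∉ F` and `v < max F`. -/
lemma hasGradedResolution_sqfreeVeronese (k ℓ : ℕ) {P : ℕ → ℕ → Prop}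
    (hP : ∀ i, i + (k + 1) ≤ n → P i (i + (k + 1))) :
    HasGradedResolution K n ℓ P (sqfreeIdeal K {F : Finset (Fin n) | F.card = k + 1})
      (subGr (shiftGr K n 0) _) := by
  classical
  have key : ∀ s : Finset (Colex (Finset (Fin n))), (∀ a ∈ s, (ofColex a).card = k + 1) →
      (∀ a ∈ s, ∀ b < a, (ofColex b).card = k + 1 → b ∈ s) →
      HasGradedResolution K n ℓ P (sqfreeIdeal K (ofColex '' (s : Set (Colex (Finset (Fin n))))))
        (subGr (shiftGr K n 0) _) := by
    intro s
    induction s using Finset.induction_on_max with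
    | empty =>
      intro _ _
      rw [Finset.coe_empty, Set.image_empty, sqfreeIdeal, Set.image_empty, Ideal.span_empty]
      exact HasGradedResolution.bot 0
    | insert a s has ih =>
      intro hcard hlower
      have hlower' : ∀ b < a, (ofColex b).card = k + 1 → b ∈ s := fun b hb hbc =>
        (Finset.mem_insert.1 (hlower a (Finset.mem_insert_self a s) b hb hbc)).resolve_left hb.ne
      have ih' := ih (fun b hb => hcard b (Finset.mem_insert_of_mem hb))
        (fun b hb c hc => hlower' c (hc.trans (has b hb)))
      obtain ⟨F, rfl⟩ := toColex.surjective a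
      have hF : F.card = k + 1 := hcard _ (Finset.mem_insert_self _ s)
      have hne : F.Nonempty := Finset.card_pos.1 (by omega)
      rw [Finset.coe_insert, Set.image_insert_eq, ofColex_toColex]
      have hdisj : Disjoint F (Finset.univ.filter fun v => v ∉ F ∧ v < F.max' hne) := by
        rw [Finset.disjoint_left]
        intro v hv hv'
        exact (Finset.mem_filter.1 hv').2.1 hv
      refine ih'.sqfreeIdeal_insert hdisj ?_ ?_ ?_
      · intro v hv
        obtain ⟨-, hvF, hvm⟩ := Finset.mem_filter.1 hv
        have hv' : v ∉ F.erase (F.max' hne) := fun h => hvF (Finset.mem_of_mem_erase h)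
        refine ⟨insert v (F.erase (F.max' hne)),
          ⟨toColex (insert v (F.erase (F.max' hne))), hlower' _ ?_ ?_, rfl⟩,
          Finset.insert_subset_insert v (Finset.erase_subset _ _)⟩
        · rw [Finset.Colex.toColex_lt_toColex_iff_exists_forall_lt]
          refine ⟨F.max' hne, F.max'_mem hne, ?_, ?_⟩
          · simp [hvm.ne']
          · intro b hb hbF
            rcases Finset.mem_insert.1 hb with rfl | hb
            · exact hvm
            · exact absurd (Finset.mem_of_mem_erase hb) hbF
        · rw [ofColex_toColex, Finset.card_insert_of_notMem hv',
            Finset.card_erase_of_mem (F.max'_mem hne), hF]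
          rfl
      · rintro _ ⟨b, hb, rfl⟩
        have hbF := has b hb
        obtain ⟨G, rfl⟩ := toColex.surjective b
        rw [ofColex_toColex]
        have hG : G.card = k + 1 := hcard _ (Finset.mem_insert_of_mem hb)
        obtain ⟨v, hvG, hvF⟩ : ∃ v ∈ G, v ∉ F := by
          rw [← Finset.not_subset]
          intro hsub
          have : G = F := Finset.eq_of_subset_of_card_le hsub (by omega)
          exact hbF.ne (congrArg toColex this)
        obtain ⟨c, hcF, -, hc⟩ := Finset.Colex.toColex_lt_toColex_iff_exists_forall_lt.1 hbF
        exact ⟨v, hvG, Finset.mem_filter.2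
          ⟨Finset.mem_univ v, hvF, (hc v hvG hvF).trans_le (F.le_max' c hcF)⟩⟩
      · intro i hi
        have h1 := Finset.card_union_of_disjoint hdisj
        have h2 := Finset.card_le_univ
          (F ∪ Finset.univ.filter fun v => v ∉ F ∧ v < F.max' hne)
        rw [Fintype.card_fin] at h2
        rw [hF]
        exact hP i (by omega)
  let _ : Fintype (Colex (Finset (Fin n))) := Fintype.ofEquiv _ toColex
  have h := key (Finset.univ.filter fun a => (ofColex a).card = k + 1) (by simp)
    (fun a _ b _ hb => by simpa using hb)
  have heq : ofColex '' ((Finset.univ.filter fun a : Colex (Finset (Fin n)) =>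
      (ofColex a).card = k + 1 : Finset _) : Set (Colex (Finset (Fin n)))) =
      {F : Finset (Fin n) | F.card = k + 1} := by
    ext F
    simp only [Set.mem_image, Finset.mem_coe, Finset.mem_filter, Finset.mem_univ, true_and]
    exact ⟨by rintro ⟨a, ha, rfl⟩; exact ha, fun hF => ⟨toColex F, hF, rfl⟩⟩
  rwa [heq] at h

/-- After all square-free monomials of degree `k + 1`, any square-free monomials of degree `k` may
be added in any order: the colon ideal at `F` is generated by all `x_v` with `v ∉ F`. -/
lemma hasGradedResolution_sqfreeVeronese_union (k ℓ : ℕ) {P : ℕ → ℕ → Prop}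
    (hP : ∀ i, i + (k + 1) ≤ n → P i (i + (k + 1))) (s : Finset (Finset (Fin n)))
    (hs : ∀ F ∈ s, F.card = k) (hP' : s.Nonempty → ∀ i, i + k ≤ n → P i (i + k)) :
    HasGradedResolution K n ℓ P
      (sqfreeIdeal K ((s : Set (Finset (Fin n))) ∪ {F : Finset (Fin n) | F.card = k + 1}))
      (subGr (shiftGr K n 0) _) := by
  classical
  induction s using Finset.induction_on with
  | empty =>
    rw [Finset.coe_empty, Set.empty_union]
    exact hasGradedResolution_sqfreeVeronese k ℓ hP
  | insert F s hFs ih =>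
    have hP'' := hP' (Finset.insert_nonempty F s)
    have hF := hs F (Finset.mem_insert_self F s)
    have ih' := ih (fun G hG => hs G (Finset.mem_insert_of_mem hG)) (fun _ => hP'')
    rw [Finset.coe_insert, Set.insert_union]
    refine ih'.sqfreeIdeal_insert (V := Fᶜ) disjoint_compl_right ?_ ?_ ?_
    · intro v hv
      refine ⟨insert v F, Or.inr ?_, subset_rfl⟩
      rw [Set.mem_ofPred_eq, Finset.card_insert_of_notMem (Finset.mem_compl.1 hv), hF]
    · intro G hG
      simp only [Finset.mem_compl]
      rw [← Finset.not_subset]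
      intro hsub
      rcases hG with hG | hG
      · have := Finset.eq_of_subset_of_card_le hsub
          (by rw [hF, hs G (Finset.mem_insert_of_mem hG)])
        exact hFs (this ▸ hG)
      · have := Finset.card_le_card hsub
        rw [Set.mem_ofPred_eq] at hG
        omega
    · intro i hi
      rw [Finset.card_compl, Fintype.card_fin] at hi
      have := Finset.card_le_univ F
      rw [Fintype.card_fin] at this
      rw [hF]
      exact hP'' i (by omega)

variable {Δ : AbstractSimplicialComplex (Fin n)} {d : ℕ}

lemma stanleyReisnerIdeal_eq_sqfreeIdeal (Δ : AbstractSimplicialComplex (Fin n)) :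
    stanleyReisnerIdeal K Δ = sqfreeIdeal K {F | ¬ IsFace Δ F} := by
  rw [stanleyReisnerIdeal, sqfreeIdeal]
  congr 1
  ext p
  exact exists_congr fun F => and_congr_right fun _ => eq_comm

lemma IsFace.subset {F G : Finset (Fin n)} (hF : IsFace Δ F) (hGF : G ⊆ F) : IsFace Δ G := by
  rcases G.eq_empty_or_nonempty with rfl | hG
  · exact Or.inl rfl
  · rcases hF with rfl | hF
    · exact absurd (Finset.subset_empty.1 hGF) hG.ne_empty
    · exact Or.inr ((Δ.isRelLowerSet_faces hF).2 hGF hG)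

lemma card_le_of_isFace (hdim : dim Δ = (d : ℤ) - 1) {F : Finset (Fin n)} (hF : IsFace Δ F) :
    F.card ≤ d := by
  classical
  have h : ((Finset.univ.filter (IsFace Δ)).sup Finset.card : ℕ) = d := by
    unfold dim at hdim
    have := sub_left_injective hdim
    convert (Int.natCast_inj.1 this)
  rw [← h]
  exact Finset.le_sup (f := Finset.card) (Finset.mem_filter.2 ⟨Finset.mem_univ F, hF⟩)

lemma exists_isFace_card_eq (hdim : dim Δ = (d : ℤ) - 1) : ∃ F, IsFace Δ F ∧ F.card = d := by
  classical
  have h : ((Finset.univ.filter (IsFace Δ)).sup Finset.card : ℕ) = d := by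
    unfold dim at hdim
    have := sub_left_injective hdim
    convert (Int.natCast_inj.1 this)
  obtain ⟨F, hF, hF'⟩ := Finset.exists_mem_eq_sup (Finset.univ.filter (IsFace Δ))
    ⟨∅, Finset.mem_filter.2 ⟨Finset.mem_univ _, Or.inl rfl⟩⟩ Finset.card
  exact ⟨F, (Finset.mem_filter.1 hF).2, by rw [← hF', h]⟩

lemma indeg_le_card {F : Finset (Fin n)} (hF : ¬ IsFace Δ F) :
    indeg (stanleyReisnerIdeal K Δ) ≤ F.card := by
  refine sInf_le ⟨F.card, rfl, sqfree K F, ?_, sqfree_ne_zero F, isHomogeneous_sqfree F⟩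
  rw [stanleyReisnerIdeal_eq_sqfreeIdeal]
  exact sqfree_mem_sqfreeIdeal hF subset_rfl

/-- If all subsets with fewer than `d` elements are faces and no subset with more than `d` elements
is, the non-faces with `d` elements and all subsets with `d + 1` elements generate `I_Δ`. -/
lemma stanleyReisnerIdeal_eq (hcard : ∀ F, IsFace Δ F → F.card ≤ d)
    (hnonface : ∀ F, ¬ IsFace Δ F → d ≤ F.card) (s : Finset (Finset (Fin n)))
    (hs : ∀ F, F ∈ s ↔ ¬ IsFace Δ F ∧ F.card = d) :
    stanleyReisnerIdeal K Δ =
      sqfreeIdeal K ((s : Set (Finset (Fin n))) ∪ {F : Finset (Fin n) | F.card = d + 1}) := by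
  rw [stanleyReisnerIdeal_eq_sqfreeIdeal]
  refine le_antisymm (Ideal.span_le.2 ?_) (Ideal.span_le.2 ?_)
  · rintro _ ⟨F, hF, rfl⟩
    rcases (hnonface F hF).eq_or_lt with h | h
    · exact sqfree_mem_sqfreeIdeal (Or.inl ((hs F).2 ⟨hF, h.symm⟩)) subset_rfl
    · obtain ⟨G, hGF, hG⟩ := Finset.exists_subset_card_eq (Nat.succ_le_of_lt h)
      exact sqfree_mem_sqfreeIdeal (Or.inr hG) hGF
  · rintro _ ⟨F, hF | hF, rfl⟩
    · exact sqfree_mem_sqfreeIdeal (𝓕 := {F | ¬ IsFace Δ F}) ((hs F).1 hF).1 subset_rfl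
    · refine sqfree_mem_sqfreeIdeal (𝓕 := {F | ¬ IsFace Δ F}) (fun h => ?_) subset_rfl
      have := hcard F h
      rw [Set.mem_ofPred_eq] at hF
      omega

/-- The degrees in homological degree `i` of a minimal resolution of `I_Δ` are `i + d + 1`, and
also `i + d` if there is a non-face with `d` elements; none exceeds `n`. -/
lemma deg_stanleyReisnerIdeal (hcard : ∀ F, IsFace Δ F → F.card ≤ d)
    (hnonface : ∀ F, ¬ IsFace Δ F → d ≤ F.card)
    (R : MinimalGradedFreeResolution (stanleyReisnerIdeal K Δ)) (i : ℕ) (b : Fin (R.rank i)) :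
    R.deg i b ≤ n ∧ (R.deg i b = i + (d + 1) ∨
      (R.deg i b = i + d ∧ ∃ F, ¬ IsFace Δ F ∧ F.card = d)) := by
  classical
  refine R.deg_of_hasGradedResolution (P := fun i j => j ≤ n ∧ (j = i + (d + 1) ∨
    (j = i + d ∧ ∃ F, ¬ IsFace Δ F ∧ F.card = d))) (fun ℓ => ?_) i b
  have hs : ∀ F, F ∈ Finset.univ.filter (fun F => ¬ IsFace Δ F ∧ F.card = d) ↔
      ¬ IsFace Δ F ∧ F.card = d := by simp
  rw [stanleyReisnerIdeal_eq hcard hnonface _ hs]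
  refine hasGradedResolution_sqfreeVeronese_union d ℓ (fun i hi => ⟨hi, Or.inl rfl⟩) _
    (fun F hF => ((hs F).1 hF).2) ?_
  rintro ⟨F, hF⟩ i hi
  exact ⟨hi, Or.inr ⟨rfl, F, (hs F).1 hF⟩⟩

lemma isComponentClosed_stanleyReisnerIdeal (Δ : AbstractSimplicialComplex (Fin n)) :
    IsComponentClosed (stanleyReisnerIdeal K Δ) := by
  rw [stanleyReisnerIdeal_eq_sqfreeIdeal]
  exact isComponentClosed_sqfreeIdeal _

/-! ### Projective dimension -/

section ProjectiveDimension

open CategoryTheory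

lemma hasProjectiveDimensionLT_range {R : Type u} [CommRing R] {A B : Type u} [AddCommGroup A]
    [Module R A] [AddCommGroup B] [Module R B] [Module.Projective R B] (φ : B →ₗ[R] A) (m : ℕ)
    (h : HasProjectiveDimensionLT (ModuleCat.of R (LinearMap.ker φ)) m) :
    HasProjectiveDimensionLT (ModuleCat.of R (LinearMap.range φ)) (m + 1) := by
  have hker : LinearMap.ker φ.rangeRestrict = LinearMap.ker φ := φ.ker_rangeRestrict
  rw [← hker] at h
  have : Projective (ModuleCat.of R B) := (IsProjective.iff_projective B).1 inferInstance
  exact (LinearMap.shortExact_shortComplexKer φ.surjective_rangeRestrict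
    ).hasProjectiveDimensionLT_X₃ m h
    (hasProjectiveDimensionLT_of_ge (ModuleCat.of R B) 1 (m + 1) (by omega))

/-- A minimal resolution with `F_m = 0` is treated from its end: the syzygy modules
`range (d i)` have projective dimension bounded by the number of remaining nonzero terms. -/
lemma MinimalGradedFreeResolution.hasProjectiveDimensionLT
    {I : Ideal (MvPolynomial (Fin n) K)} (F : MinimalGradedFreeResolution I) {m : ℕ}
    (hm : F.rank m = 0) :
    HasProjectiveDimensionLT (ModuleCat.of (MvPolynomial (Fin n) K) I) m := by
  have key : ∀ m i, F.rank (i + 1 + m) = 0 → HasProjectiveDimensionLT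
      (ModuleCat.of (MvPolynomial (Fin n) K) (LinearMap.range (F.d i))) m := by
    intro m
    induction m with
    | zero =>
      intro i hi
      have : IsEmpty (Fin (F.rank (i + 1))) := by
        rw [show F.rank (i + 1) = 0 from hi]
        infer_instance
      have hs : Subsingleton (LinearMap.range (F.d i)) :=
        (F.d i).surjective_rangeRestrict.subsingleton
      exact (ModuleCat.isZero_of_subsingleton _).hasProjectiveDimensionLT_zero
    | succ m ih =>
      intro i hi
      refine hasProjectiveDimensionLT_range (F.d i) m ?_
      rw [← F.exact_succ i]
      exact ih (i + 1) (by rw [← hi]; congr 1; omega)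
  cases m with
  | zero =>
    have : IsEmpty (Fin (F.rank 0)) := by
      rw [hm]
      infer_instance
    have hs : Subsingleton I := by
      have : Subsingleton (LinearMap.range F.aug) :=
        F.aug.surjective_rangeRestrict.subsingleton
      rwa [F.range_aug] at this
    exact (ModuleCat.isZero_of_subsingleton _).hasProjectiveDimensionLT_zero
  | succ m =>
    have h := hasProjectiveDimensionLT_range F.aug m (by
      rw [← F.exact_zero]
      exact key m 0 (by rw [← hm]; congr 1; omega))
    rwa [F.range_aug] at h

lemma smul_id_comp_ext {C : Type*} [Category C] [Abelian C] [HasExt.{u} C] {R : Type*} [CommRing R]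
    [Linear R C] {X Y : C} {k : ℕ} (r : R) (e : Abelian.Ext X Y k) :
    (Abelian.Ext.mk₀ (r • 𝟙 X)).comp e (zero_add k) = r • e := by
  rw [Abelian.Ext.mk₀_smul, Abelian.Ext.smul_comp, Abelian.Ext.mk₀_id_comp]

/-- Multiplication by a variable outside `V` on `S/(x_v : v ∈ V)`, with its cokernel. -/
noncomputable def varShortComplex (K : Type u) [Field K] {n : ℕ} (V : Finset (Fin n)) (v : Fin n) :
    ShortComplex (ModuleCat.{u} (MvPolynomial (Fin n) K)) :=
  ShortComplex.mk
    ((X v : MvPolynomial (Fin n) K) •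
      𝟙 (ModuleCat.of (MvPolynomial (Fin n) K) (MvPolynomial (Fin n) K ⧸ varIdeal K V)))
    (ModuleCat.ofHom (Submodule.factor (p := varIdeal K V) (p' := varIdeal K (insert v V))
      (Ideal.span_mono (Set.image_mono (Finset.coe_subset.2 (Finset.subset_insert v V)))))) (by
      refine ModuleCat.hom_ext (LinearMap.ext fun y => ?_)
      obtain ⟨f, rfl⟩ := Submodule.Quotient.mk_surjective _ y
      exact (Submodule.Quotient.mk_eq_zero _).2
        (Ideal.mul_mem_right f _ (X_mem_varIdeal (Finset.mem_insert_self v V))))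

lemma varShortComplex_shortExact {V : Finset (Fin n)} {v : Fin n} (hv : v ∉ V) :
    (varShortComplex K V v).ShortExact := by
  have hXv : (X v : MvPolynomial (Fin n) K) ∉ varIdeal K V := by
    have := sqfree_mem_varIdeal (K := K) (F := {v}) (V := V)
    simpa [sqfree, hv] using this
  have hf : ∀ f : MvPolynomial (Fin n) K, (varShortComplex K V v).f.hom (Submodule.Quotient.mk f) =
      Submodule.Quotient.mk (X v * f) := fun f => rfl
  have hg : ∀ f : MvPolynomial (Fin n) K, (varShortComplex K V v).g.hom (Submodule.Quotient.mk f) =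
      Submodule.Quotient.mk f := fun f => rfl
  refine { exact := ?_, mono_f := ?_, epi_g := ?_ }
  · rw [ShortComplex.moduleCat_exact_iff]
    intro y hy
    obtain ⟨f, rfl⟩ := Submodule.Quotient.mk_surjective _ y
    have hy' : f ∈ varIdeal K (insert v V) :=
      (Submodule.Quotient.mk_eq_zero _).1 ((hg f).symm.trans hy)
    rw [varIdeal, Finset.coe_insert, Set.image_insert_eq, Ideal.span_insert,
      Ideal.mem_span_singleton_sup] at hy'
    obtain ⟨p, q, hq, rfl⟩ := hy'
    refine ⟨Submodule.Quotient.mk p, (hf p).trans ((Submodule.Quotient.eq _).2 ?_)⟩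
    rw [mul_comm, sub_add_cancel_left]
    exact neg_mem hq
  · rw [ModuleCat.mono_iff_injective]
    refine (injective_iff_map_eq_zero _).2 fun y hy => ?_
    obtain ⟨f, rfl⟩ := Submodule.Quotient.mk_surjective _ y
    have hy' : X v * f ∈ varIdeal K V :=
      (Submodule.Quotient.mk_eq_zero _).1 ((hf f).symm.trans hy)
    exact (Submodule.Quotient.mk_eq_zero _).2
      (((isPrime_varIdeal V).mem_or_mem hy').resolve_left hXv)
  · rw [ModuleCat.epi_iff_surjective]
    intro y
    obtain ⟨f, rfl⟩ := Submodule.Quotient.mk_surjective _ y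
    exact ⟨Submodule.Quotient.mk f, hg f⟩

/-- If `Y` is killed by the variables in `V` but not by `r`, neither is `Ext^{|V|}(S/(V), Y)`
killed by `r`: adjoining a variable to `V`, the connecting homomorphism is injective, because the
variable acts as zero on `Ext` into `Y`. -/
lemma exists_ext_smul_ne_zero (V : Finset (Fin n))
    (Y : ModuleCat.{u} (MvPolynomial (Fin n) K)) (r : MvPolynomial (Fin n) K)
    (hY : ∀ v ∈ V, ∀ y : Y, (X v : MvPolynomial (Fin n) K) • y = 0) (hr : ∃ y : Y, r • y ≠ 0)
    (k : ℕ) (hk : V.card = k) :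
    ∃ e : Abelian.Ext.{u} (ModuleCat.of (MvPolynomial (Fin n) K)
      (MvPolynomial (Fin n) K ⧸ varIdeal K V)) Y k, r • e ≠ 0 := by
  classical
  induction V using Finset.induction_on generalizing k with
  | empty =>
    obtain rfl : k = 0 := by simpa using hk.symm
    obtain ⟨y, hy⟩ := hr
    let f : ModuleCat.of (MvPolynomial (Fin n) K)
        (MvPolynomial (Fin n) K ⧸ varIdeal K (∅ : Finset (Fin n))) ⟶ Y :=
      ModuleCat.ofHom ((varIdeal K ∅).liftQ (LinearMap.toSpanSingleton _ Y y)
        (by simp [varIdeal]))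
    refine ⟨Abelian.Ext.mk₀ f, ?_⟩
    rw [← Abelian.Ext.mk₀_smul]
    intro h0
    rw [Abelian.Ext.mk₀_eq_zero_iff] at h0
    refine hy ?_
    have h1 := congrArg (fun φ => φ.hom (Submodule.Quotient.mk 1)) h0
    have h2 : (r • f).hom (Submodule.Quotient.mk 1) = r • ((1 : MvPolynomial (Fin n) K) • y) := rfl
    rw [one_smul] at h2
    exact h2.symm.trans h1
  | insert v V hv ih =>
    subst hk
    obtain ⟨e, he⟩ := ih (fun w hw => hY w (Finset.mem_insert_of_mem hw)) V.card rfl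
    have hS := varShortComplex_shortExact (K := K) hv
    have hcard : 1 + V.card = (insert v V).card := by
      rw [Finset.card_insert_of_notMem hv, add_comm]
    refine ⟨hS.extClass.comp e hcard, fun h0 => he ?_⟩
    obtain ⟨e', he'⟩ := Abelian.Ext.contravariant_sequence_exact₁ hS Y (r • e) hcard
      ((Abelian.Ext.comp_smul _ _ _ _).trans h0)
    have hX : (X v : MvPolynomial (Fin n) K) • 𝟙 Y = 0 := by
      ext y
      exact hY v (Finset.mem_insert_self v V) y
    rw [← he']
    refine (smul_id_comp_ext (X v : MvPolynomial (Fin n) K) e').trans ?_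
    rw [Abelian.Ext.smul_eq_comp_mk₀, hX, Abelian.Ext.mk₀_zero, Abelian.Ext.comp_zero]
    rfl

/-- A facet with `d` vertices forces `pd I_Δ ≥ n - d - 1`. For such a face `H`, multiplication by
`∏_{v ∈ H} x_v` on `S/(x_v : v ∉ H)` factors through `S/I_Δ`, whereas it does not
annihilate `Ext^{n-d}(S/(x_v : v ∉ H), S/(x_v : v ∉ H))`. -/
lemma not_hasProjectiveDimensionLT_stanleyReisnerIdeal {Δ : AbstractSimplicialComplex (Fin n)}
    {H : Finset (Fin n)} (hH : IsFace Δ H) (hfacet : ∀ v ∉ H, ¬ IsFace Δ (insert v H)) {m : ℕ}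
    (hm : H.card + (m + 1) = n) :
    ¬ HasProjectiveDimensionLT
      (ModuleCat.of (MvPolynomial (Fin n) K) (stanleyReisnerIdeal K Δ)) m := by
  intro hI
  set I := stanleyReisnerIdeal K Δ with hIdef
  have hZ : HasProjectiveDimensionLT
      (ModuleCat.of (MvPolynomial (Fin n) K) (MvPolynomial (Fin n) K ⧸ I)) (m + 1) := by
    have hker : LinearMap.ker (Submodule.mkQ I) = I := Submodule.ker_mkQ I
    have hI' : HasProjectiveDimensionLT
        (ModuleCat.of (MvPolynomial (Fin n) K) (LinearMap.ker (Submodule.mkQ I))) m := by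
      rwa [hker]
    have : Projective (ModuleCat.of (MvPolynomial (Fin n) K) (MvPolynomial (Fin n) K)) :=
      (IsProjective.iff_projective _).1 inferInstance
    exact (LinearMap.shortExact_shortComplexKer (Submodule.mkQ_surjective I)
      ).hasProjectiveDimensionLT_X₃ m hI' (hasProjectiveDimensionLT_of_ge
        (ModuleCat.of (MvPolynomial (Fin n) K) (MvPolynomial (Fin n) K)) 1 (m + 1) (by omega))
  have hcard : (Hᶜ).card = m + 1 := by
    rw [Finset.card_compl, Fintype.card_fin]
    omega
  have hIV : I ≤ varIdeal K Hᶜ := by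
    rw [hIdef, stanleyReisnerIdeal_eq_sqfreeIdeal]
    refine Ideal.span_le.2 ?_
    rintro _ ⟨G, hG, rfl⟩
    refine sqfree_mem_varIdeal.2 ?_
    simp only [Finset.mem_compl]
    rw [← Finset.not_subset]
    exact fun h => hG (hH.subset h)
  have hVI : varIdeal K Hᶜ ≤ Submodule.comap
      (LinearMap.toSpanSingleton (MvPolynomial (Fin n) K) _ (sqfree K H)) I := by
    refine Submodule.span_le.2 ?_
    rintro _ ⟨v, hv, rfl⟩
    have hvH : v ∉ H := Finset.mem_compl.1 hv
    have : sqfree K (insert v H) ∈ I := by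
      rw [hIdef, stanleyReisnerIdeal_eq_sqfreeIdeal]
      exact sqfree_mem_sqfreeIdeal (𝓕 := {F | ¬ IsFace Δ F}) (hfacet v hvH) subset_rfl
    rwa [sqfree, Finset.prod_insert hvH] at this
  let φ : ModuleCat.of (MvPolynomial (Fin n) K) (MvPolynomial (Fin n) K ⧸ varIdeal K Hᶜ) ⟶
      ModuleCat.of (MvPolynomial (Fin n) K) (MvPolynomial (Fin n) K ⧸ I) :=
    ModuleCat.ofHom (Submodule.mapQ _ _ _ hVI)
  let ψ : ModuleCat.of (MvPolynomial (Fin n) K) (MvPolynomial (Fin n) K ⧸ I) ⟶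
      ModuleCat.of (MvPolynomial (Fin n) K) (MvPolynomial (Fin n) K ⧸ varIdeal K Hᶜ) :=
    ModuleCat.ofHom (Submodule.factor hIV)
  have hφψ : φ ≫ ψ = sqfree K H • 𝟙 _ := by
    ext
    change Submodule.Quotient.mk ((1 : MvPolynomial (Fin n) K) • sqfree K H) =
      Submodule.Quotient.mk (sqfree K H • (1 : MvPolynomial (Fin n) K))
    rw [smul_eq_mul, smul_eq_mul, mul_comm]
  obtain ⟨e, he⟩ := exists_ext_smul_ne_zero (K := K) Hᶜ
    (ModuleCat.of (MvPolynomial (Fin n) K) (MvPolynomial (Fin n) K ⧸ varIdeal K Hᶜ)) (sqfree K H)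
    (fun v hv y => by
      obtain ⟨f, rfl⟩ := Submodule.Quotient.mk_surjective _ y
      refine (Submodule.Quotient.mk_eq_zero _).2 ?_
      exact Ideal.mul_mem_right f _ (X_mem_varIdeal hv))
    ⟨Submodule.Quotient.mk 1, fun h => by
      have h' : sqfree K H * 1 ∈ varIdeal K Hᶜ := (Submodule.Quotient.mk_eq_zero _).1 h
      rw [mul_one, sqfree_mem_varIdeal] at h'
      obtain ⟨v, hv, hv'⟩ := h'
      exact Finset.mem_compl.1 hv' hv⟩ (m + 1) hcard
  refine he ?_
  rw [← smul_id_comp_ext, ← hφψ, ← Abelian.Ext.mk₀_comp_mk₀_assoc,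
    ((Abelian.Ext.mk₀ ψ).comp e (zero_add _)).eq_zero_of_hasProjectiveDimensionLT (m + 1) le_rfl,
    Abelian.Ext.comp_zero]

end ProjectiveDimension

/-! ### Betti numbers and regularity -/

namespace MinimalGradedFreeResolution

variable {I : Ideal (MvPolynomial (Fin n) K)} (F : MinimalGradedFreeResolution I)

lemma betti_ne_zero_iff {i j : ℕ} : F.betti i j ≠ 0 ↔ ∃ b, F.deg i b = j := by
  rw [betti, Finset.card_ne_zero]
  simp [Finset.Nonempty]

lemma reg_le {k : ℤ} (h : ∀ i b, (F.deg i b : ℤ) - i ≤ k) :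
    F.reg ≤ ((k : ℤ) : WithBot (WithTop ℤ)) := by
  refine sSup_le ?_
  rintro _ ⟨i, j, hij, rfl⟩
  obtain ⟨b, rfl⟩ := F.betti_ne_zero_iff.1 hij
  exact WithBot.coe_le_coe.2 (WithTop.coe_le_coe.2 (h i b))

lemma le_reg {k : ℤ} (i : ℕ) (b : Fin (F.rank i)) (h : k ≤ (F.deg i b : ℤ) - i) :
    ((k : ℤ) : WithBot (WithTop ℤ)) ≤ F.reg :=
  (WithBot.coe_le_coe.2 (WithTop.coe_le_coe.2 h)).trans
    (le_sSup ⟨i, F.deg i b, F.betti_ne_zero_iff.2 ⟨b, rfl⟩, rfl⟩)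

lemma nonempty_fin_rank_zero (hI : I ≠ ⊥) : Nonempty (Fin (F.rank 0)) := by
  by_contra h
  rw [not_nonempty_iff] at h
  refine hI ?_
  rw [← F.range_aug, LinearMap.range_eq_bot]
  exact Subsingleton.elim _ _

end MinimalGradedFreeResolution

lemma exists_nonface_card_eq {Δ : AbstractSimplicialComplex (Fin n)} {d : ℕ}
    (hdim : dim Δ = (d : ℤ) - 1) (hI : stanleyReisnerIdeal K Δ ≠ ⊥) :
    d < n ∧ ∃ F, ¬ IsFace Δ F ∧ F.card = d + 1 := by
  obtain ⟨G, hG⟩ : ∃ G, ¬ IsFace Δ G := by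
    by_contra! h
    refine hI ?_
    rw [stanleyReisnerIdeal_eq_sqfreeIdeal, sqfreeIdeal]
    simp [h]
  obtain ⟨H, hH, hHd⟩ := exists_isFace_card_eq hdim
  have hdn : d < n := by
    have h1 : H ≠ Finset.univ := fun h => hG (hH.subset (h ▸ Finset.subset_univ G))
    have h2 := Finset.card_lt_card (Finset.ssubset_univ_iff.2 h1)
    rwa [hHd, Finset.card_univ, Fintype.card_fin] at h2
  refine ⟨hdn, ?_⟩
  obtain ⟨F, -, hF⟩ := Finset.exists_subset_card_eq
    (show d + 1 ≤ (Finset.univ : Finset (Fin n)).card by simpa using hdn)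
  refine ⟨F, fun h => ?_, hF⟩
  have := card_le_of_isFace hdim h
  omega

end StanleyReisner

theorem mainTheorem3 {K : Type*} [Field K] {n d : ℕ} (Δ : AbstractSimplicialComplex (Fin n))
    (hdim : StanleyReisner.dim Δ = (d : ℤ) - 1)
    (hindeg : (d : ℕ∞) ≤ StanleyReisner.indeg (StanleyReisner.stanleyReisnerIdeal K Δ)) :
    -- the minimal graded free resolution, in terms of which `β_{i,j}` is defined, exists
    Nonempty (StanleyReisner.MinimalGradedFreeResolution
      (StanleyReisner.stanleyReisnerIdeal K Δ)) ∧
    -- (i)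
    (∀ (F : StanleyReisner.MinimalGradedFreeResolution (StanleyReisner.stanleyReisnerIdeal K Δ))
      (i j : ℕ), F.betti i j ≠ 0 →
        (1 ≤ j ∧ j ≤ n) ∧ (d : ℤ) ≤ (j : ℤ) - i ∧ (j : ℤ) - i ≤ (d : ℤ) + 1) ∧
    (StanleyReisner.stanleyReisnerIdeal K Δ ≠ ⊥ →
      -- (ii)
      (∀ F : StanleyReisner.MinimalGradedFreeResolution (StanleyReisner.stanleyReisnerIdeal K Δ),
        ((d : ℤ) : WithBot (WithTop ℤ)) ≤ F.reg ∧
          F.reg ≤ (((d : ℤ) + 1 : ℤ) : WithBot (WithTop ℤ))) ∧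
      -- (iii)
      StanleyReisner.indeg (StanleyReisner.stanleyReisnerIdeal K Δ) ≤ (d : ℕ∞) + 1 ∧
      (∀ F : StanleyReisner.MinimalGradedFreeResolution (StanleyReisner.stanleyReisnerIdeal K Δ),
        StanleyReisner.indeg (StanleyReisner.stanleyReisnerIdeal K Δ) = (d : ℕ∞) + 1 ↔
          F.IsLinear (d + 1)) ∧
      -- (iv): `n - d - 1 ≤ projdim I_Δ ≤ n - d`, written without subtraction
      (n : WithBot ℕ∞) ≤ CategoryTheory.projectiveDimension
        (ModuleCat.of (MvPolynomial (Fin n) K) (StanleyReisner.stanleyReisnerIdeal K Δ)) + d + 1 ∧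
      CategoryTheory.projectiveDimension
        (ModuleCat.of (MvPolynomial (Fin n) K) (StanleyReisner.stanleyReisnerIdeal K Δ)) + d ≤
          (n : WithBot ℕ∞)) := by
  open StanleyReisner in
  have hcard : ∀ F, IsFace Δ F → F.card ≤ d := fun F hF => card_le_of_isFace hdim hF
  have hnonface : ∀ F, ¬ IsFace Δ F → d ≤ F.card := fun F hF =>
    Nat.cast_le.1 (hindeg.trans (indeg_le_card hF))
  have hdeg := fun R : MinimalGradedFreeResolution (stanleyReisnerIdeal K Δ) =>
    deg_stanleyReisnerIdeal hcard hnonface R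
  have hex := MinimalGradedFreeResolution.nonempty
    (isComponentClosed_stanleyReisnerIdeal (K := K) Δ)
  refine ⟨hex, ?_, fun hI => ?_⟩
  · intro F i j hij
    obtain ⟨b, rfl⟩ := F.betti_ne_zero_iff.1 hij
    obtain ⟨h1, h2⟩ := hdeg F i b
    refine ⟨⟨?_, h1⟩, by omega, by omega⟩
    rcases h2 with h2 | ⟨h2, G, hG, hGd⟩
    · omega
    · -- the empty set is a face, so `d > 0` here
      have : G.Nonempty := Finset.nonempty_iff_ne_empty.2 fun h => hG (Or.inl h)
      have := this.card_pos
      omega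
  · obtain ⟨hdn, G, hG, hGd⟩ := exists_nonface_card_eq hdim hI
    have hind : indeg (stanleyReisnerIdeal K Δ) ≤ (d : ℕ∞) + 1 := by
      have := indeg_le_card (K := K) hG
      rwa [hGd, Nat.cast_add, Nat.cast_one] at this
    have hreg : ∀ F : MinimalGradedFreeResolution (stanleyReisnerIdeal K Δ),
        F.reg ≤ (((d : ℤ) + 1 : ℤ) : WithBot (WithTop ℤ)) := fun F => F.reg_le fun i b => by
      have := (hdeg F i b).2
      omega
    refine ⟨fun F => ⟨?_, hreg F⟩, hind, fun F => ⟨fun h => ?_, fun h => ?_⟩, ?_, ?_⟩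
    · obtain ⟨b⟩ := F.nonempty_fin_rank_zero hI
      refine F.le_reg 0 b ?_
      have := (hdeg F 0 b).2
      omega
    · obtain ⟨b⟩ := F.nonempty_fin_rank_zero hI
      refine ⟨le_antisymm ?_ (F.le_reg 0 b ?_), ?_⟩
      · rw [Nat.cast_add, Nat.cast_one]
        exact hreg F
      · rcases (hdeg F 0 b).2 with h2 | ⟨-, G', hG', hGd'⟩
        · omega
        · have h3 := indeg_le_card (K := K) hG'
          rw [h, hGd'] at h3
          exact absurd (Nat.cast_le.1 (by exact_mod_cast h3 : ((d + 1 : ℕ) : ℕ∞) ≤ (d : ℕ∞)))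
            (by omega)
      · rw [h, Nat.cast_add, Nat.cast_one]
    · rw [h.2, Nat.cast_add, Nat.cast_one]
    · obtain ⟨H, hH, hHd⟩ := exists_isFace_card_eq hdim
      have hfacet : ∀ v ∉ H, ¬ IsFace Δ (insert v H) := fun v hv hF => by
        have := hcard _ hF
        rw [Finset.card_insert_of_notMem hv] at this
        omega
      have h := not_hasProjectiveDimensionLT_stanleyReisnerIdeal (K := K) hH hfacet
        (m := n - d - 1) (by omega)
      have h' := (CategoryTheory.projectiveDimension_ge_iff _ _).2 h
      have hn : (n : WithBot ℕ∞) = ((n - d - 1 : ℕ) : WithBot ℕ∞) + d + 1 := by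
        have : n = n - d - 1 + d + 1 := by omega
        exact_mod_cast this
      rw [hn]
      gcongr
    · obtain ⟨F⟩ := hex
      have hrank : F.rank (n - d + 1) = 0 := by
        by_contra hne
        have := hdeg F (n - d + 1) ⟨0, Nat.pos_of_ne_zero hne⟩
        omega
      have h' := (CategoryTheory.projectiveDimension_le_iff _ _).2
        (F.hasProjectiveDimensionLT hrank)
      have hn : (n : WithBot ℕ∞) = ((n - d : ℕ) : WithBot ℕ∞) + d := by
        have : n = n - d + d := by omega
        exact_mod_cast this
      rw [hn]
      gcongr
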